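/- Let $K$ be a local field of characteristic $p>0$ (a non-discrete locally compact non-Archimedean field), with ring of integers $\mathfrak D=\{|x|\le 1\}$, maximal ideal $\mathfrak B=\{|x|<1\}$, residue field $\mathfrak D/\mathfrak B$ of order $q=p^c$, prime element $\mathfrak p$, absolute value normalized by $|\mathfrak p|=q^{-1}$, and Haar measure $dx$ on $K^+$ normalized so that $\mathfrak D$ has measure $1$. Let $1=\epsilon_0,\epsilon_1,\dots,\epsilon_{c-1}\in K$ be such that their $GF(p)$-span is a subfield of $K$ with $q$ elements. For $0\le b<q$ with $b=\sum_{k<c}a_kp^k$, $0\le a_k<p$, put $u(b)=\big(\sum_{k<c}a_k\epsilon_k\big)\mathfrak p^{-1}$, and for $n=\sum_k b_kq^k$, $0\le b_k<q$, put $u(n)=\sum_k\mathfrak p^{-k}u(b_k)$. Let $\chi$ be a continuous unitary character of $K^+$ that is trivial on $\mathfrak D$, non-trivial on $\mathfrak p^{-1}\mathfrak D$, and satisfies $\chi(\epsilon_k\mathfrak p^{-j})=1$ for $0\le k<c$ and $j\ge 2$ (for instance the one with $\chi(\epsilon_0\mathfrak p^{-1})=e^{2\pi i/p}$ and $\chi(\epsilon_k\mathfrak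 p^{-j})=1$ for all other $k$ and $j\ge1$). The Fourier transform on $L^2(K)$ is the $L^2$-extension of $\hat f(\xi)=\int_K f(x)\chi(-\xi x)\,dx$. Functions $\psi^1,\dots,\psi^L\in L^2(K)$ form a multiwavelet of order $L$ if the affine system $q^{j/2}\psi^l(\mathfrak p^{-j}\,\cdot\,-u(t))$ ($j\in\mathbb Z$, $t\in\mathbb N_0$, $1\le l\le L$) is an orthonormal basis of $L^2(K)$. For measurable $W_1,\dots,W_L\subset K$, the union $W=\bigcup_{m=1}^L W_m$ is called a multiwavelet set of order $L$ with components $W_1,\dots,W_L$ if there is a multiwavelet $\{\psi^1,\dots,\psi^L\}$ with $\widehat{\psi^m}=\mathbb 1_{W_m}$ a.e. for $m=1,\dots,L$. **Theorem.** Let $\psi^1,\dots,\psi^L\in L^2(K)$ satisfy $\widehat{\psi^m}=\mathbb 1_{W_m}$ a.e. with $W_1,\dots,W_L\subset K$ measurable, and let $W=\bigcup_{m=1}^L W_m$. Then the following are equivalent: 1. $W$ is a multiwavelet set with components $W_1,\dots,W_L$. 2. (a) for all $1\le l,m\le L$ and all integers $j\ge 0$, $$\sum_{t\in\mathbb N_0}\mathbb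 1_{W_l\cap\mathfrak p^jW_m}(\xi+u(t))=\delta_{j,0}\,\delta_{l,m}\quad\text{for a.e. }\xi\in K;$$ (b) $\{\mathfrak p^jW_m: j\in\mathbb Z,\ 1\le m\le L\}$ is a measurable partition of $K$ up to null sets. 3. Condition (a) holds and $\displaystyle\int_W\frac{1}{|\xi|}\,d\xi=\frac{q-1}{q}$. -/

import Mathlib

open MeasureTheory Filter Topology Metric
open scoped ENNReal Pointwise

noncomputable section

/-- The cardinality `q` of the residue field `𝔇/𝔅` of a non-Archimedean normed field,
where `𝔇 = {‖x‖ ≤ 1}` and `𝔅 = {‖x‖ < 1}`. -/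
def residueCard (K : Type*) [NontriviallyNormedField K] [IsUltrametricDist K] : ℕ :=
  Nat.card (IsLocalRing.ResidueField (NormedField.valuation (K := K)).valuationSubring)

/-- The choices entering the definition of affine systems and of the Fourier transform on a
local field of characteristic `p` with residue field of order `q = p ^ c`, the norm being the
normalized absolute value: a prime element `𝔭`, elements `ε₀ = 1, ε₁, …, ε_{c-1}` whose
`GF(p)`-span is a copy of `GF(q)` in `K`, and a unitary character `χ` of the additive group. -/
structure AffineSetting (K : Type*) [NontriviallyNormedField K] [IsUltrametricDist K]
    (p c : ℕ) where
  /-- `q = p ^ c` -/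
  card_residue : residueCard K = p ^ c
  /-- the prime element `𝔭` -/
  unif : K
  /-- `𝔭` lies in `𝔅` … -/
  norm_unif_lt : ‖unif‖ < 1
  /-- … and has maximal absolute value there -/
  norm_le_unif : ∀ x : K, ‖x‖ < 1 → ‖x‖ ≤ ‖unif‖
  /-- the absolute value is the normalized one -/
  norm_unif : ‖unif‖ = ((p : ℝ) ^ c)⁻¹
  /-- the elements `ε₀, …, ε_{c-1}` -/
  ε : Fin c → K
  ε_zero : ∀ h : 0 < c, ε ⟨0, h⟩ = 1
  /-- the `GF(p)`-span of the `ε_k` (in characteristic `p` this is the additive subgroup that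
  they generate) is a subfield with `p ^ c` elements -/
  ε_span : ∃ F : Subfield K, Nat.card F = p ^ c ∧
    (AddSubgroup.closure (Set.range ε) : Set K) = F
  /-- the character `χ` -/
  χ : AddChar K Circle
  χ_cont : Continuous χ
  /-- `χ` is trivial on `𝔇` -/
  χ_integers : ∀ x : K, ‖x‖ ≤ 1 → χ x = 1
  /-- `χ` is non-trivial on `𝔅⁻¹ = 𝔭⁻¹𝔇` -/
  χ_nontrivial : ∃ x : K, ‖x‖ ≤ (p : ℝ) ^ c ∧ χ x ≠ 1
  /-- `χ(ε_k 𝔭^{-j}) = 1` for `j ≥ 2` -/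
  χ_ε : ∀ (k : Fin c) (j : ℕ), 2 ≤ j → χ (ε k * unif ^ (-(j : ℤ))) = 1

namespace AffineSetting

variable {K : Type*} [NontriviallyNormedField K] [IsUltrametricDist K] {p c : ℕ}
  (S : AffineSetting K p c)

/-- The order `q = p ^ c` of the residue field. -/
def q (_S : AffineSetting K p c) : ℕ := p ^ c

/-- `u(b) = (∑_{i<c} aᵢ εᵢ) 𝔭⁻¹` for a digit `0 ≤ b < q` with base-`p` expansion
`b = ∑_{i<c} aᵢ pⁱ`. -/
def uDigit (b : ℕ) : K :=
  (∑ i : Fin c, ((b / p ^ (i : ℕ) % p : ℕ) : K) * S.ε i) * S.unif⁻¹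

/-- The translations `u(n) = ∑_k 𝔭^{-k} u(b_k)`, where `n = ∑_k b_k q^k` is the base-`q`
expansion of `n` (`b_k = 0` for `k > n`). -/
def u (n : ℕ) : K :=
  ∑ k ∈ Finset.range (n + 1), S.unif ^ (-(k : ℤ)) * S.uDigit (n / S.q ^ k % S.q)

variable [MeasurableSpace K]

/-- `g` is the Fourier transform of the square integrable function `f`: it is the `L²` limit, as
`n → ∞`, of the integrals `∫_{|x| ≤ n} f(x) χ(-ξx) dx`. -/
def IsFourierTransform (μ : Measure K) (f g : K → ℂ) : Prop :=
  Tendsto (fun n : ℕ => eLpNorm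
      (fun ξ => Fourier.fourierIntegral S.χ μ ((closedBall (0 : K) (n : ℝ)).indicator f) ξ - g ξ)
      2 μ)
    atTop (𝓝 0)

/-- The function `f_{j,t}(x) = q^{j/2} f(𝔭^{-j} x - u(t))`. -/
def affine (f : K → ℂ) (j : ℤ) (t : ℕ) : K → ℂ := fun x =>
  (((S.q : ℝ) ^ ((j : ℝ) / 2) : ℝ) : ℂ) * f (S.unif ^ (-j) * x - S.u t)

/-- `{ψ¹, …, ψᴸ} ⊆ L²(K)` is a multiwavelet of order `L`: the affine system `ψˡ_{j,t}`
is an orthonormal basis of `L²(K)`. -/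
def IsMultiwavelet (μ : Measure K) {L : ℕ} (ψ : Fin L → Lp ℂ 2 μ) : Prop :=
  ∃ b : HilbertBasis (Fin L × ℤ × ℕ) ℂ (Lp ℂ 2 μ),
    ∀ l j t, b (l, j, t) =ᵐ[μ] S.affine (ψ l) j t

/-- `⋃ₗ Wₗ` is a multiwavelet set of order `L` with components `W₁, …, W_L`: the sets `Wₗ` are
measurable and `1_{Wₗ} = ψ̂ˡ` for a multiwavelet `{ψ¹, …, ψᴸ}`. -/
def IsMultiwaveletSet (μ : Measure K) {L : ℕ} (W : Fin L → Set K) : Prop :=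
  (∀ l, MeasurableSet (W l)) ∧
    ∃ ψ : Fin L → Lp ℂ 2 μ, S.IsMultiwavelet μ ψ ∧
      ∀ l, S.IsFourierTransform μ (ψ l) ((W l).indicator 1)

/-- The set-orthogonality condition: for all `l, m` and all `j ≥ 0`,
`∑_t 1_{W_l ∩ 𝔭^j W_m}(ξ + u(t)) = δ_{j,0} δ_{l,m}` for a.e. `ξ`. The sum of these nonnegative
terms is taken in `[0, ∞]`. -/
def SetOrthogonality (μ : Measure K) {L : ℕ} (W : Fin L → Set K) : Prop :=
  ∀ (l m : Fin L) (j : ℕ), ∀ᵐ ξ ∂μ,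
    ∑' t : ℕ, (W l ∩ S.unif ^ j • W m).indicator (fun _ => (1 : ℝ≥0∞)) (ξ + S.u t)
      = if j = 0 ∧ l = m then 1 else 0

/-- `{𝔭^j W_m : j ∈ ℤ, 1 ≤ m ≤ L}` is a measurable partition of `K` up to null sets. -/
def DilatesPartition (μ : Measure K) {L : ℕ} (W : Fin L → Set K) : Prop :=
  (∀ (j : ℤ) (m : Fin L), MeasurableSet (S.unif ^ j • W m)) ∧
  (Pairwise fun a b : ℤ × Fin L =>
    AEDisjoint μ (S.unif ^ a.1 • W a.2) (S.unif ^ b.1 • W b.2)) ∧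
  ∀ᵐ ξ ∂μ, ∃ (j : ℤ) (m : Fin L), ξ ∈ S.unif ^ j • W m

end AffineSetting

end

/-! The translations `u(t)` form a group Λ which behaves towards 𝔇 as ℤ does towards a unit
interval: K is the disjoint union of the cosets `u(t) + 𝔇`, `𝔭⁻¹Λ ⊆ Λ`, and χ is trivial on products
of two elements of Λ. Hence the characters `χ(· l)`, `l ∈ Λ`, are Λ-periodic and play the role of
Fourier series: an integrable f with `∫ f χ(· l) = 0` for all `l ∈ Λ` has periodization `∑_t f(ξ +
u(t)) = 0` a.e. (`ae_tsum_add_u_eq_zero`).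

On the Fourier side the affine function with indices l, j, t becomes `q^{-j/2} χ(-𝔭^j u(t) ξ)` on
`𝔭^{-j} W_l` and 0 elsewhere (`fourierL2_affine`, `spectralVec`). After rescaling, the inner product
of two of these whose levels differ by `i ≥ 0` is `q^{i/2}` times a Fourier coefficient, at a point
of Λ, of the periodization of `1_{W_l ∩ 𝔭^i W_m}` (`inner_spectralVec_spectralVec`). Orthonormality
prescribes all these coefficients, and so says exactly that the periodizations are the constants in
(a) (`orthonormal_spectralVec_iff`).

Given (a), each `W_m` is a fundamental domain of Λ, so the lattice characters are complete on it and
the system is complete on every `𝔭^j W_m`; completeness in `L²(K)` therefore means that these sets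
cover K (`cover_of_complete`, `complete_of_cover`). Their disjointness is already part of (a), as
follows by integrating over 𝔇. Finally `dξ/|ξ|` is dilation invariant, so under (a) the integral
over W measures the part of the unit sphere covered by the dilates of W. The sphere has measure
`(q-1)/q`, and covering it amounts to covering K (`cover_iff_lintegral`).

The `L²` transform is built as the unitary map matching two Gabor bases (`exists_fourier_isometry`)
and is then identified with the limit of truncated integrals. -/

namespace AffineSetting

/-! ### The absolute value, the coefficient field GF(q) and the self-dual lattice of translations.
-/

section Algebra

variable {K : Type*} [NontriviallyNormedField K] [IsUltrametricDist K] {p c : ℕ}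
  (S : AffineSetting K p c)

theorem norm_unif_eq : ‖S.unif‖ = (S.q : ℝ)⁻¹ := by
  simp [S.norm_unif, q]

theorem one_lt_q [Fact p.Prime] : 1 < S.q := by
  have hp : 1 < p := (Fact.out : p.Prime).one_lt
  rcases Nat.eq_zero_or_pos c with hc | hc
  -- The case `c = 0` is excluded because it would give `‖𝔭‖ = 1`.
  · subst hc
    have h1 := S.norm_unif
    have h2 := S.norm_unif_lt
    simp at h1
    linarith
  · exact Nat.one_lt_pow hc.ne' hp

theorem one_lt_q_real [Fact p.Prime] : (1 : ℝ) < S.q := by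
  exact_mod_cast S.one_lt_q

theorem q_pos [Fact p.Prime] : (0 : ℝ) < S.q := zero_lt_one.trans S.one_lt_q_real

theorem unif_ne_zero [Fact p.Prime] : S.unif ≠ 0 := by
  rw [← norm_pos_iff, S.norm_unif_eq]
  exact inv_pos.2 S.q_pos

theorem norm_unif_zpow (n : ℤ) : ‖S.unif ^ n‖ = (S.q : ℝ) ^ (-n) := by
  rw [norm_zpow, S.norm_unif_eq, inv_zpow, zpow_neg]

/-- If `q^n ≤ ‖x‖ < q^(n+1)`, then `𝔭^(n+1) x` lies in 𝔅, and maximality of `‖𝔭‖` there pushes `‖x‖`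
down to `q^n`. -/
theorem norm_eq_zpow_of_ne_zero [Fact p.Prime] {x : K} (hx : x ≠ 0) :
    ∃ n : ℤ, ‖x‖ = (S.q : ℝ) ^ n := by
  obtain ⟨n, h1, h2⟩ := exists_mem_Ico_zpow (norm_pos_iff.2 hx) S.one_lt_q_real
  refine ⟨n, le_antisymm ?_ h1⟩
  have hq := S.q_pos
  have h3 : ‖x * S.unif ^ (n + 1)‖ = ‖x‖ * (S.q : ℝ) ^ (-(n + 1)) := by
    rw [norm_mul, S.norm_unif_zpow]
  have h4 : ‖x * S.unif ^ (n + 1)‖ < 1 := by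
    rw [h3, zpow_neg, ← div_eq_mul_inv, div_lt_one (by positivity)]
    exact h2
  have h5 := S.norm_le_unif _ h4
  rw [h3, S.norm_unif_eq, zpow_neg, ← div_eq_mul_inv, div_le_iff₀ (by positivity),
    zpow_add_one₀ hq.ne', mul_comm, mul_assoc, mul_inv_cancel₀ hq.ne', mul_one] at h5
  exact h5

/-- The copy of `GF(q)` in `K` spanned by the `ε_k`. -/
noncomputable def coeffField : Subfield K := S.ε_span.choose

theorem card_coeffField : Nat.card S.coeffField = S.q := S.ε_span.choose_spec.1

theorem closure_eps_eq_coeffField :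
    (AddSubgroup.closure (Set.range S.ε) : Set K) = S.coeffField := S.ε_span.choose_spec.2

theorem finite_coeffField [Fact p.Prime] : Finite S.coeffField := by
  apply Nat.finite_of_card_ne_zero
  rw [S.card_coeffField]
  exact (zero_lt_one.trans S.one_lt_q).ne'

/-- Nonzero elements of a finite field are roots of unity. -/
theorem norm_eq_one_of_mem_coeffField [Fact p.Prime] {a : K} (ha : a ∈ S.coeffField)
    (h0 : a ≠ 0) : ‖a‖ = 1 := by
  have := S.finite_coeffField
  have := Fintype.ofFinite S.coeffField
  have h := FiniteField.pow_card_sub_one_eq_one (⟨a, ha⟩ : S.coeffField)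
    (fun h => h0 (congrArg Subtype.val h))
  have h1 : a ^ (Fintype.card S.coeffField - 1) = 1 := congrArg Subtype.val h
  rw [← Nat.card_eq_fintype_card, S.card_coeffField] at h1
  have h2 : ‖a‖ ^ (S.q - 1) = 1 := by rw [← norm_pow, h1, norm_one]
  exact (pow_eq_one_iff_of_nonneg (norm_nonneg a) (Nat.sub_pos_of_lt S.one_lt_q).ne').1 h2

theorem norm_le_one_of_mem_coeffField [Fact p.Prime] {a : K} (ha : a ∈ S.coeffField) :
    ‖a‖ ≤ 1 := by
  by_cases h : a = 0
  · simp [h]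
  · exact (S.norm_eq_one_of_mem_coeffField ha h).le

theorem eq_of_mem_coeffField_of_norm_sub_lt [Fact p.Prime] {a b : K} (ha : a ∈ S.coeffField)
    (hb : b ∈ S.coeffField) (h : ‖a - b‖ < 1) : a = b := by
  by_contra hne
  exact h.ne (S.norm_eq_one_of_mem_coeffField (sub_mem ha hb) (sub_ne_zero.2 hne))

theorem valuation_le_one_iff (x : K) : NormedField.valuation x ≤ 1 ↔ ‖x‖ ≤ 1 := by
  rw [← NNReal.coe_le_coe]; simp

/-- Reduction modulo 𝔅 is injective on GF(q), since nonzero differences have norm 1. The residue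
field also has q elements, so reduction is bijective and GF(q) represents all residue classes. -/
theorem exists_coeffField_norm_sub_lt [Fact p.Prime] {x : K} (hx : ‖x‖ ≤ 1) :
    ∃ a ∈ S.coeffField, ‖x - a‖ < 1 := by
  let O := (NormedField.valuation (K := K)).valuationSubring
  have hO : ∀ y : K, y ∈ O ↔ ‖y‖ ≤ 1 := fun y => valuation_le_one_iff y
  have hres : ∀ y z : O, IsLocalRing.residue O y = IsLocalRing.residue O z ↔
      ‖(y : K) - z‖ < 1 := by
    intro y z
    rw [← sub_eq_zero, ← map_sub, IsLocalRing.residue_eq_zero_iff, IsLocalRing.mem_maximalIdeal,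
      mem_nonunits_iff]
    change ¬ IsUnit (y - z) ↔ ‖((y - z : O) : K)‖ < 1
    generalize y - z = w
    have hw := (hO w).1 w.2
    rw [← not_le, not_iff_not]
    constructor
    · intro h
      obtain ⟨v, hv⟩ := h.exists_right_inv
      have h1 : ‖(w : K)‖ * ‖(v : K)‖ = 1 := by
        rw [← norm_mul, ← norm_one (α := K)]
        exact congrArg (fun o : O => ‖(o : K)‖) hv
      have hv1 := (hO v).1 v.2
      nlinarith [norm_nonneg (w : K), norm_nonneg (v : K)]
    · intro h
      have h1 : ‖(w : K)‖ = 1 := le_antisymm hw h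
      have h0 : (w : K) ≠ 0 := norm_ne_zero_iff.1 (by rw [h1]; exact one_ne_zero)
      exact IsUnit.of_mul_eq_one ⟨(w : K)⁻¹, (hO _).2 (by rw [norm_inv, h1, inv_one])⟩
        (Subtype.ext (mul_inv_cancel₀ h0))
  have := S.finite_coeffField
  let f : S.coeffField → IsLocalRing.ResidueField O := fun a =>
    IsLocalRing.residue O ⟨a, (hO a).2 (S.norm_le_one_of_mem_coeffField a.2)⟩
  have hf : Function.Injective f := by
    intro a b hab
    exact Subtype.ext (S.eq_of_mem_coeffField_of_norm_sub_lt a.2 b.2 ((hres _ _).1 hab))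
  have hcard : Nat.card (IsLocalRing.ResidueField O) = S.q := S.card_residue
  have : Finite (IsLocalRing.ResidueField O) := by
    apply Nat.finite_of_card_ne_zero
    rw [hcard]
    exact (zero_lt_one.trans S.one_lt_q).ne'
  have hb : Function.Bijective f :=
    hf.bijective_of_nat_card_le (by rw [hcard, S.card_coeffField])
  obtain ⟨a, ha⟩ := hb.2 (IsLocalRing.residue O ⟨x, (hO x).2 hx⟩)
  exact ⟨a, a.2, (hres ⟨x, (hO x).2 hx⟩ ⟨a, _⟩).1 ha.symm⟩

/-- The element of `GF(q)` with the base-`p` digits of `b`. -/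
noncomputable def digit (b : ℕ) : K := ∑ i : Fin c, ((b / p ^ (i : ℕ) % p : ℕ) : K) * S.ε i

theorem eps_mem_coeffField (i : Fin c) : S.ε i ∈ S.coeffField := by
  have : S.ε i ∈ (S.coeffField : Set K) := by
    rw [← S.closure_eps_eq_coeffField]
    exact AddSubgroup.subset_closure ⟨i, rfl⟩
  exact this

theorem digit_mem (b : ℕ) : S.digit b ∈ S.coeffField :=
  sum_mem fun i _ => mul_mem (natCast_mem _ _) (S.eps_mem_coeffField i)

theorem digit_zero : S.digit 0 = 0 := by simp [digit]

/-- An integer combination of the `ε_k` may have its coefficients reduced modulo p because K has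
characteristic p; the reduced coefficients are the base-p digits of b. -/
theorem exists_digit_eq [Fact p.Prime] [CharP K p] {a : K} (ha : a ∈ S.coeffField) :
    ∃ b < S.q, S.digit b = a := by
  have ha' : a ∈ (AddSubgroup.closure (Set.range S.ε) : Set K) := by
    rw [S.closure_eps_eq_coeffField]; exact ha
  have hp : (p : ℤ) ≠ 0 := by exact_mod_cast (Fact.out : p.Prime).ne_zero
  rw [SetLike.mem_coe, ← Submodule.span_int_eq_addSubgroupClosure, Submodule.mem_toAddSubgroup,
    Submodule.mem_span_range_iff_exists_fun] at ha'
  obtain ⟨z, hz⟩ := ha'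
  have hlt : ∀ i, (z i % p).toNat < p := fun i => by
    have h1 := Int.emod_nonneg (z i) hp
    have h2 := Int.emod_lt_of_pos (z i) (b := p) (by omega)
    omega
  let v : Fin c → Fin p := fun i => ⟨(z i % p).toNat, hlt i⟩
  refine ⟨finFunctionFinEquiv v, (finFunctionFinEquiv v).2, ?_⟩
  rw [digit, ← hz]
  refine Finset.sum_congr rfl fun i _ => ?_
  have h : ((finFunctionFinEquiv v : ℕ) / p ^ (i : ℕ) % p) = (z i % p).toNat := by
    have := congrArg Fin.val (congrFun (finFunctionFinEquiv.symm_apply_apply v) i)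
    rwa [finFunctionFinEquiv_symm_apply_val] at this
  rw [h, zsmul_eq_mul]
  congr 1
  have h3 : (((z i % p).toNat : ℤ) : K) = ((z i % p : ℤ) : K) := by
    rw [Int.toNat_of_nonneg (Int.emod_nonneg (z i) hp)]
  rw [← Int.cast_natCast, h3]
  exact (CharP.intCast_eq_intCast K p).2 (Int.mod_modEq _ _)

/-- A surjection between two sets of q elements is injective; linear independence of the `ε_k` is
never needed separately. -/
theorem digit_injOn [Fact p.Prime] [CharP K p] {b b' : ℕ} (hb : b < S.q) (hb' : b' < S.q)
    (h : S.digit b = S.digit b') : b = b' := by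
  have := S.finite_coeffField
  let f : Fin S.q → S.coeffField := fun b => ⟨S.digit b, S.digit_mem b⟩
  have hs : Function.Surjective f := fun a => by
    obtain ⟨b, hb, h⟩ := S.exists_digit_eq a.2
    exact ⟨⟨b, hb⟩, Subtype.ext h⟩
  have hi : Function.Bijective f :=
    hs.bijective_of_nat_card_le (by rw [S.card_coeffField, Nat.card_fin])
  exact congrArg Fin.val (@hi.1 ⟨b, hb⟩ ⟨b', hb'⟩ (Subtype.ext h))

theorem u_zero : S.u 0 = 0 := by
  have := S.digit_zero
  simp only [digit] at this
  simp [u, uDigit]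

/-- Digits of index beyond n vanish since `n < q^k`, so the cut-off in the definition of `u` can be
raised freely. -/
theorem u_eq_sum [Fact p.Prime] {n N : ℕ} (h : n < N) :
    S.u n = ∑ k ∈ Finset.range N, S.unif ^ (-(k : ℤ)) * (S.digit (n / S.q ^ k % S.q) * S.unif⁻¹) := by
  refine Finset.sum_subset (Finset.range_subset_range.2 h) fun k _ hk => ?_
  have hk' : n < k := by simpa using hk
  have : n / S.q ^ k = 0 := Nat.div_eq_of_lt (hk'.trans (Nat.lt_pow_self S.one_lt_q))
  change _ * (S.digit _ * _) = 0
  simp [this, S.digit_zero]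

/-- Splitting off the lowest base-q digit gives the recursion on which the inductions over
translations rest. -/
theorem u_eq [Fact p.Prime] (n : ℕ) :
    S.u n = S.unif⁻¹ * (S.digit (n % S.q) + S.u (n / S.q)) := by
  rw [S.u_eq_sum (N := n + 2) (by omega), Finset.sum_range_succ',
    S.u_eq_sum (n := n / S.q) (N := n + 1) (Nat.lt_succ_of_le (Nat.div_le_self _ _)), mul_add,
    Finset.mul_sum, add_comm]
  congr 1
  · simp [mul_comm]
  · refine Finset.sum_congr rfl fun k _ => ?_
    rw [Nat.div_div_eq_div_mul, ← pow_succ']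
    have : S.unif ^ (-((k + 1 : ℕ) : ℤ)) = S.unif⁻¹ * S.unif ^ (-(k : ℤ)) := by
      rw [← zpow_neg_one, ← zpow_add₀ S.unif_ne_zero]
      congr 1
      push_cast
      ring
    rw [this]
    ring

theorem u_add_mul [Fact p.Prime] {b : ℕ} (hb : b < S.q) (k : ℕ) :
    S.u (b + S.q * k) = S.unif⁻¹ * (S.digit b + S.u k) := by
  have hq : 0 < S.q := zero_lt_one.trans S.one_lt_q
  rw [S.u_eq, Nat.add_mul_mod_self_left, Nat.mod_eq_of_lt hb, Nat.add_mul_div_left _ _ hq,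
    Nat.div_eq_of_lt hb, zero_add]

/-- Digits are added in GF(q) without carrying, so the index k is in general not `m + n`. -/
theorem u_add [Fact p.Prime] [CharP K p] (m n : ℕ) : ∃ k, S.u k = S.u m + S.u n := by
  induction m using Nat.strong_induction_on generalizing n with
  | _ m ih =>
    rcases Nat.eq_zero_or_pos m with rfl | hm
    · exact ⟨n, by simp [S.u_zero]⟩
    · obtain ⟨k, hk⟩ := ih (m / S.q) (Nat.div_lt_self hm S.one_lt_q) (n / S.q)
      obtain ⟨b, hb, hb'⟩ := S.exists_digit_eq
        (add_mem (S.digit_mem (m % S.q)) (S.digit_mem (n % S.q)))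
      exact ⟨b + S.q * k, by rw [S.u_add_mul hb, hk, hb', S.u_eq m, S.u_eq n]; ring⟩

theorem u_neg [Fact p.Prime] [CharP K p] (m : ℕ) : ∃ k, S.u k = -S.u m := by
  induction m using Nat.strong_induction_on with
  | _ m ih =>
    rcases Nat.eq_zero_or_pos m with rfl | hm
    · exact ⟨0, by simp [S.u_zero]⟩
    · obtain ⟨k, hk⟩ := ih (m / S.q) (Nat.div_lt_self hm S.one_lt_q)
      obtain ⟨b, hb, hb'⟩ := S.exists_digit_eq (neg_mem (S.digit_mem (m % S.q)))
      exact ⟨b + S.q * k, by rw [S.u_add_mul hb, hk, hb', S.u_eq m]; ring⟩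

/-- The group of translations. -/
def lattice [Fact p.Prime] [CharP K p] : AddSubgroup K where
  carrier := Set.range S.u
  zero_mem' := ⟨0, S.u_zero⟩
  add_mem' := by
    rintro _ _ ⟨m, rfl⟩ ⟨n, rfl⟩
    exact S.u_add m n
  neg_mem' := by
    rintro _ ⟨m, rfl⟩
    exact S.u_neg m

theorem u_mem_lattice [Fact p.Prime] [CharP K p] (n : ℕ) : S.u n ∈ S.lattice := ⟨n, rfl⟩

theorem digit_mul_mem_lattice [Fact p.Prime] [CharP K p] {a : K} (ha : a ∈ S.coeffField) :
    S.unif⁻¹ * a ∈ S.lattice := by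
  obtain ⟨b, hb, rfl⟩ := S.exists_digit_eq ha
  exact ⟨b + S.q * 0, by rw [S.u_add_mul hb, S.u_zero, add_zero]⟩

theorem unif_inv_mul_mem_lattice [Fact p.Prime] [CharP K p] {x : K} (hx : x ∈ S.lattice) :
    S.unif⁻¹ * x ∈ S.lattice := by
  obtain ⟨k, rfl⟩ := hx
  exact ⟨0 + S.q * k, by
    rw [S.u_add_mul (zero_lt_one.trans S.one_lt_q), S.digit_zero, zero_add]⟩

theorem unif_inv_pow_mul_mem_lattice [Fact p.Prime] [CharP K p] {x : K} (hx : x ∈ S.lattice)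
    (n : ℕ) : S.unif⁻¹ ^ n * x ∈ S.lattice := by
  induction n with
  | zero => simpa
  | succ n ih => rw [pow_succ', mul_assoc]; exact S.unif_inv_mul_mem_lattice ih

/-- The difference is `𝔭⁻¹(d + e)`, with d the difference of the lowest digits and e that of the
remaining parts. Norm at most 1 forces `‖d + e‖ < 1`, hence `‖e‖ ≤ 1`; induction gives `e = 0`, and
then `‖d‖ < 1` makes the digits equal. -/
theorem eq_of_norm_u_sub_le [Fact p.Prime] [CharP K p] {m n : ℕ}
    (h : ‖S.u m - S.u n‖ ≤ 1) : m = n := by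
  induction hN : m + n using Nat.strong_induction_on generalizing m n with
  | _ N ih =>
    rcases Nat.eq_zero_or_pos N with h0 | hpos
    · omega
    · have hq := S.one_lt_q
      set d := S.digit (m % S.q) - S.digit (n % S.q) with hd
      set e := S.u (m / S.q) - S.u (n / S.q) with he
      have h1 : S.u m - S.u n = S.unif⁻¹ * (d + e) := by
        rw [S.u_eq m, S.u_eq n, hd, he]; ring
      have h2 : ‖d + e‖ < 1 := by
        rw [h1, norm_mul, norm_inv, S.norm_unif_eq, inv_inv] at h
        nlinarith [S.one_lt_q_real, norm_nonneg (d + e)]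
      have hd1 : ‖d‖ ≤ 1 :=
        S.norm_le_one_of_mem_coeffField (sub_mem (S.digit_mem _) (S.digit_mem _))
      have he1 : ‖e‖ ≤ 1 := by
        have := IsUltrametricDist.norm_add_le_max (d + e) (-d)
        rw [add_neg_cancel_comm, norm_neg] at this
        exact this.trans (max_le h2.le hd1)
      have hlt : m / S.q + n / S.q < N := by
        rcases Nat.eq_zero_or_pos m with hm | hm
        · have := Nat.div_lt_self (show 0 < n by omega) hq
          have := Nat.div_le_self m S.q
          omega
        · have := Nat.div_lt_self hm hq
          have := Nat.div_le_self n S.q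
          omega
      have hdiv := ih _ hlt he1 rfl
      have he0 : e = 0 := by rw [he, hdiv, sub_self]
      rw [he0, add_zero] at h2
      have hmod := S.digit_injOn (Nat.mod_lt _ (by omega)) (Nat.mod_lt _ (by omega))
        (S.eq_of_mem_coeffField_of_norm_sub_lt (S.digit_mem _) (S.digit_mem _) h2)
      rw [← Nat.div_add_mod m S.q, ← Nat.div_add_mod n S.q, hdiv, hmod]

theorem u_injective [Fact p.Prime] [CharP K p] : Function.Injective S.u := fun m n h =>
  S.eq_of_norm_u_sub_le (by rw [h, sub_self, norm_zero]; exact zero_le_one)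

/-- Subtracting a leading term `a 𝔭^{-(n+1)}`, with `a ∈ GF(q)` representing the residue of `𝔭^(n+1)
x`, lowers the norm bound by a factor q and stays within the lattice. -/
theorem exists_lattice_norm_sub_le_aux [Fact p.Prime] [CharP K p] (n : ℕ) (x : K)
    (hx : ‖x‖ ≤ (S.q : ℝ) ^ n) : ∃ l ∈ S.lattice, ‖x - l‖ ≤ 1 := by
  induction n generalizing x with
  | zero => exact ⟨0, zero_mem _, by simpa using hx⟩
  | succ n ih =>
    have hq := S.q_pos
    have hu := S.unif_ne_zero
    have h1 : ‖S.unif ^ (n + 1) * x‖ ≤ 1 := by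
      rw [norm_mul, norm_pow, S.norm_unif_eq, inv_pow, inv_mul_le_iff₀ (by positivity), mul_one]
      exact hx
    obtain ⟨a, ha, hlt⟩ := S.exists_coeffField_norm_sub_lt h1
    have h2 := S.norm_le_unif _ hlt
    have hl : S.unif⁻¹ ^ n * (S.unif⁻¹ * a) ∈ S.lattice :=
      S.unif_inv_pow_mul_mem_lattice (S.digit_mul_mem_lattice ha) n
    have h3 : x - S.unif⁻¹ ^ n * (S.unif⁻¹ * a) =
        (S.unif⁻¹) ^ (n + 1) * (S.unif ^ (n + 1) * x - a) := by
      rw [mul_sub, ← mul_assoc (S.unif⁻¹ ^ (n + 1)), ← mul_pow, inv_mul_cancel₀ hu, one_pow,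
        one_mul, pow_succ]
      ring
    obtain ⟨l, hl', hle⟩ := ih (x - S.unif⁻¹ ^ n * (S.unif⁻¹ * a)) (by
      rw [h3, norm_mul, norm_pow, norm_inv]
      rw [S.norm_unif_eq] at h2 ⊢
      rw [inv_inv]
      calc (S.q : ℝ) ^ (n + 1) * ‖S.unif ^ (n + 1) * x - a‖
          ≤ (S.q : ℝ) ^ (n + 1) * (S.q : ℝ)⁻¹ := by gcongr
        _ = (S.q : ℝ) ^ n := by rw [pow_succ, mul_assoc, mul_inv_cancel₀ hq.ne', mul_one])
    exact ⟨_ + l, add_mem hl hl', by rwa [← sub_sub]⟩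

theorem exists_norm_sub_u_le [Fact p.Prime] [CharP K p] (x : K) :
    ∃ t, ‖x - S.u t‖ ≤ 1 := by
  obtain ⟨n, hn⟩ := pow_unbounded_of_one_lt ‖x‖ S.one_lt_q_real
  obtain ⟨_, ⟨t, rfl⟩, h⟩ := S.exists_lattice_norm_sub_le_aux n x hn.le
  exact ⟨t, h⟩

theorem chi_coeff [Fact p.Prime] {a : K} (ha : a ∈ S.coeffField) (j : ℕ) (hj : 2 ≤ j) :
    S.χ (a * S.unif⁻¹ ^ j) = 1 := by
  have ha' : a ∈ AddSubgroup.closure (Set.range S.ε) := by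
    rw [← SetLike.mem_coe, S.closure_eps_eq_coeffField]; exact ha
  induction ha' using AddSubgroup.closure_induction with
  | mem x hx =>
    obtain ⟨k, rfl⟩ := hx
    have := S.χ_ε k j hj
    rwa [zpow_neg, zpow_natCast, ← inv_pow] at this
  | zero => simp
  | add x y hx hy h1 h2 =>
    have m : ∀ z, z ∈ AddSubgroup.closure (Set.range S.ε) → z ∈ S.coeffField := fun z hz => by
      rw [← SetLike.mem_coe, ← S.closure_eps_eq_coeffField]; exact hz
    rw [add_mul, AddChar.map_add_eq_mul, h1 (m x hx), h2 (m y hy), one_mul]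
  | neg x hx h1 =>
    have m : x ∈ S.coeffField := by
      rw [← SetLike.mem_coe, ← S.closure_eps_eq_coeffField]; exact hx
    rw [neg_mul, AddChar.map_neg_eq_inv, h1 m, inv_one]

theorem chi_coeff_mul_u [Fact p.Prime] {a : K} (ha : a ∈ S.coeffField) (n j : ℕ) :
    S.χ (a * S.unif⁻¹ ^ (j + 1) * S.u n) = 1 := by
  induction n using Nat.strong_induction_on generalizing j with
  | _ n ih =>
    rcases Nat.eq_zero_or_pos n with rfl | hn
    · simp [S.u_zero]
    · have h : a * S.unif⁻¹ ^ (j + 1) * S.u n = a * S.digit (n % S.q) * S.unif⁻¹ ^ (j + 2) +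
          a * S.unif⁻¹ ^ (j + 1 + 1) * S.u (n / S.q) := by
        rw [S.u_eq n]; ring
      rw [h, AddChar.map_add_eq_mul, ih _ (Nat.div_lt_self hn S.one_lt_q),
        S.chi_coeff (mul_mem ha (S.digit_mem _)) _ (by omega), one_mul]

/-- Every translation involves only powers `𝔭^{-k}` with `k ≥ 1`, so a product of two involves only
`k ≥ 2`, with coefficients in GF(q), where χ is trivial. The extra factor `𝔭^{-j}` makes the
induction go through. -/
theorem chi_unif_mul_u_mul_u [Fact p.Prime] (m n j : ℕ) :
    S.χ (S.unif⁻¹ ^ j * S.u m * S.u n) = 1 := by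
  induction m using Nat.strong_induction_on generalizing j with
  | _ m ih =>
    rcases Nat.eq_zero_or_pos m with rfl | hm
    · simp [S.u_zero]
    · have h : S.unif⁻¹ ^ j * S.u m * S.u n =
          S.digit (m % S.q) * S.unif⁻¹ ^ (j + 1) * S.u n +
          S.unif⁻¹ ^ (j + 1) * S.u (m / S.q) * S.u n := by
        rw [S.u_eq m]; ring
      rw [h, AddChar.map_add_eq_mul, ih _ (Nat.div_lt_self hm S.one_lt_q),
        S.chi_coeff_mul_u (S.digit_mem _), one_mul]

theorem chi_mul_of_mem_lattice [Fact p.Prime] [CharP K p] {x y : K} (hx : x ∈ S.lattice)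
    (hy : y ∈ S.lattice) : S.χ (x * y) = 1 := by
  obtain ⟨m, rfl⟩ := hx
  obtain ⟨n, rfl⟩ := hy
  simpa using S.chi_unif_mul_u_mul_u m n 0

/-- Divide by ξ a point of `𝔭⁻¹𝔇` at which χ is nontrivial; the norm is discrete, so `‖ξ‖ ≥
q^(n+1)`, which absorbs the factor q. -/
theorem exists_chi_mul_ne_one [Fact p.Prime] {ξ : K} {n : ℤ} (h : (S.q : ℝ) ^ n < ‖ξ‖) :
    ∃ x : K, ‖x‖ ≤ (S.q : ℝ) ^ (-n) ∧ S.χ (x * ξ) ≠ 1 := by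
  have hq := S.q_pos
  have h0 : ξ ≠ 0 := norm_pos_iff.1 (lt_trans (by positivity) h)
  obtain ⟨k, hk⟩ := S.norm_eq_zpow_of_ne_zero h0
  rw [hk, zpow_lt_zpow_iff_right₀ S.one_lt_q_real] at h
  obtain ⟨x, hx, hne⟩ := S.χ_nontrivial
  refine ⟨x / ξ, ?_, by rwa [div_mul_cancel₀ _ h0]⟩
  have hx' : ‖x‖ ≤ (S.q : ℝ) := by simpa [q] using hx
  rw [norm_div, hk, div_le_iff₀ (by positivity), ← zpow_add₀ hq.ne']
  refine hx'.trans ?_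
  conv_lhs => rw [← zpow_one (S.q : ℝ)]
  exact zpow_le_zpow_right₀ S.one_lt_q_real.le (by omega)

end Algebra

/-! ### Haar measure under dilation by powers of the prime element. -/

section Scaling

variable {K : Type*} [NontriviallyNormedField K] [IsUltrametricDist K] {p c : ℕ}
  (S : AffineSetting K p c)

theorem mem_zpow_smul_iff [Fact p.Prime] (j : ℤ) (E : Set K) (x : K) :
    x ∈ S.unif ^ j • E ↔ S.unif ^ (-j) * x ∈ E := by
  rw [Set.mem_smul_set_iff_inv_smul_mem₀ (zpow_ne_zero _ S.unif_ne_zero), zpow_neg, smul_eq_mul]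

theorem zpow_neg_mul_cancel [Fact p.Prime] (j : ℤ) (x : K) :
    S.unif ^ (-j) * (S.unif ^ j * x) = x := by
  rw [← mul_assoc, ← zpow_add₀ S.unif_ne_zero]; simp

theorem norm_zpow_mul_le_iff [Fact p.Prime] (j : ℤ) (x : K) (r : ℝ) :
    ‖S.unif ^ j * x‖ ≤ r ↔ ‖x‖ ≤ (S.q : ℝ) ^ j * r := by
  have hq := S.q_pos
  rw [norm_mul, S.norm_unif_zpow, zpow_neg, inv_mul_le_iff₀ (by positivity)]

variable [MeasurableSpace K] [BorelSpace K]

/-- Multiplication by `𝔭 ^ j`. -/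
noncomputable def dilation [Fact p.Prime] (j : ℤ) : K ≃ᵐ K :=
  (Homeomorph.mulLeft₀ (S.unif ^ j) (zpow_ne_zero _ S.unif_ne_zero)).toMeasurableEquiv

@[simp]
theorem dilation_apply [Fact p.Prime] (j : ℤ) (x : K) : S.dilation j x = S.unif ^ j * x := rfl

theorem zpow_smul_eq_preimage [Fact p.Prime] (j : ℤ) (E : Set K) :
    S.unif ^ j • E = S.dilation (-j) ⁻¹' E := by
  ext x
  exact S.mem_zpow_smul_iff j E x

variable [ProperSpace K] (μ : Measure K) [μ.IsAddHaarMeasure]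

omit [IsUltrametricDist K] [ProperSpace K] in
theorem measure_closedBall_center (a : K) (r : ℝ) :
    μ (closedBall a r) = μ (closedBall 0 r) := by
  have : closedBall a r = (fun x => x + -a) ⁻¹' closedBall 0 r := by
    ext x; simp [dist_eq_norm, sub_eq_add_neg]
  rw [this, measure_preimage_add_right]

variable {μ} (hμ : μ (closedBall (0 : K) 1) = 1)

include hμ

omit [ProperSpace K] in
-- 𝔇 is the disjoint union of q translates of 𝔅, centred at the elements of GF(q).
theorem measure_closedBall_inv [Fact p.Prime] [CharP K p] :
    μ (closedBall (0 : K) (S.q : ℝ)⁻¹) = (S.q : ℝ≥0∞)⁻¹ := by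
  have hq := S.one_lt_q_real
  have hlt : ∀ {y : K}, ‖y‖ ≤ (S.q : ℝ)⁻¹ → ‖y‖ < 1 := fun h =>
    h.trans_lt (inv_lt_one_of_one_lt₀ hq)
  have hun : closedBall (0 : K) 1 = ⋃ b : Fin S.q, closedBall (S.digit b) (S.q : ℝ)⁻¹ := by
    ext x
    simp only [mem_closedBall, Set.mem_iUnion, dist_eq_norm, sub_zero]
    constructor
    · intro hx
      obtain ⟨a, ha, h⟩ := S.exists_coeffField_norm_sub_lt hx
      obtain ⟨b, hb, rfl⟩ := S.exists_digit_eq ha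
      exact ⟨⟨b, hb⟩, by simpa [S.norm_unif_eq] using S.norm_le_unif _ h⟩
    · rintro ⟨b, hb⟩
      have := IsUltrametricDist.norm_add_le_max (x - S.digit b) (S.digit b)
      rw [sub_add_cancel] at this
      exact this.trans (max_le (hlt hb).le (S.norm_le_one_of_mem_coeffField (S.digit_mem _)))
  have hdis : Pairwise (Function.onFun Disjoint
      fun b : Fin S.q => closedBall (S.digit b) (S.q : ℝ)⁻¹) := by
    intro b b' hbb
    rw [Function.onFun, Set.disjoint_left]
    intro x hx hx'
    rw [mem_closedBall, dist_eq_norm] at hx hx'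
    apply hbb
    apply Fin.ext
    apply S.digit_injOn b.2 b'.2
    apply S.eq_of_mem_coeffField_of_norm_sub_lt (S.digit_mem _) (S.digit_mem _)
    have := IsUltrametricDist.norm_add_le_max (x - S.digit b') (-(x - S.digit b))
    rw [norm_neg] at this
    have e : x - S.digit b' + -(x - S.digit b) = S.digit b - S.digit b' := by ring
    rw [e] at this
    exact this.trans_lt (max_lt (hlt hx') (hlt hx))
  have h := measure_iUnion (μ := μ) hdis (fun b => measurableSet_closedBall)
  rw [← hun, hμ] at h
  simp only [measure_closedBall_center μ (S.digit _), ENNReal.tsum_const] at h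
  apply ENNReal.eq_inv_of_mul_eq_one_left
  rw [h, mul_comm]
  simp

/-- Uniqueness of Haar measure leaves only a constant to find for `j = 1`, read off from the ball of
radius `1/q`, whose preimage is 𝔇. Induction in both directions gives all integers. -/
theorem map_dilation [Fact p.Prime] [CharP K p] (j : ℤ) :
    μ.map (S.dilation j) = ENNReal.ofReal ((S.q : ℝ) ^ j) • μ := by
  have hq := S.q_pos
  have hcomp : ∀ i k : ℤ, μ.map (S.dilation (i + k)) = (μ.map (S.dilation i)).map (S.dilation k) := by
    intro i k
    rw [Measure.map_map (S.dilation k).measurable (S.dilation i).measurable]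
    congr 1
    ext x
    simp only [dilation_apply, Function.comp]
    rw [zpow_add₀ S.unif_ne_zero]; ring
  have h1 : μ.map (S.dilation 1) = ENNReal.ofReal (S.q : ℝ) • μ := by
    have : (μ.map (S.dilation 1)).IsAddHaarMeasure :=
      AddEquiv.isAddHaarMeasure_map μ
        (DistribMulAction.toAddEquiv₀ K (S.unif ^ (1 : ℤ)) (zpow_ne_zero _ S.unif_ne_zero))
        (Homeomorph.mulLeft₀ _ (zpow_ne_zero 1 S.unif_ne_zero)).continuous
        (Homeomorph.mulLeft₀ _ (zpow_ne_zero 1 S.unif_ne_zero)).symm.continuous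
    have e := Measure.isAddLeftInvariant_eq_smul (μ.map (S.dilation 1)) μ
    have e1 := congrArg (fun m => m (closedBall (0 : K) (S.q : ℝ)⁻¹)) e
    have hpre : S.dilation 1 ⁻¹' closedBall (0 : K) (S.q : ℝ)⁻¹ = closedBall 0 1 := by
      ext x
      rw [Set.mem_preimage, mem_closedBall, mem_closedBall, dist_zero_right, dist_zero_right,
        dilation_apply, S.norm_zpow_mul_le_iff, zpow_one, mul_inv_cancel₀ hq.ne']
    rw [MeasurableEquiv.map_apply, hpre, hμ, Measure.smul_apply,
      S.measure_closedBall_inv hμ, ENNReal.smul_def, smul_eq_mul] at e1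
    have e2 := ENNReal.eq_inv_of_mul_eq_one_left e1.symm
    rw [inv_inv] at e2
    rw [e, ENNReal.ofReal_natCast, ← e2]
    rfl
  have hsucc : ∀ k : ℤ, μ.map (S.dilation k) = ENNReal.ofReal ((S.q : ℝ) ^ k) • μ ↔
      μ.map (S.dilation (k + 1)) = ENNReal.ofReal ((S.q : ℝ) ^ (k + 1)) • μ := by
    intro k
    rw [zpow_add_one₀ hq.ne', mul_comm ((S.q : ℝ) ^ k), ENNReal.ofReal_mul hq.le, mul_smul]
    have hne : ENNReal.ofReal (S.q : ℝ) ≠ 0 := by simpa using hq.ne'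
    constructor
    · intro h
      rw [add_comm, hcomp, h1, Measure.map_smul, h]
    · intro h
      rw [add_comm, hcomp, h1, Measure.map_smul] at h
      ext s hs
      have := congrArg (fun m => m s) h
      simp only [Measure.smul_apply, smul_eq_mul] at this ⊢
      exact (ENNReal.mul_right_inj hne ENNReal.ofReal_ne_top).1 this
  induction j using Int.induction_on with
  | zero =>
    have : (S.dilation 0 : K → K) = id := by ext x; simp
    simp [this]
  | succ k ih => exact (hsucc _).1 ih
  | pred k ih => exact (hsucc _).2 (by simpa using ih)

theorem lintegral_zpow_mul [Fact p.Prime] [CharP K p] (j : ℤ) (f : K → ℝ≥0∞) :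
    ∫⁻ x, f (S.unif ^ j * x) ∂μ = ENNReal.ofReal ((S.q : ℝ) ^ j) * ∫⁻ x, f x ∂μ := by
  rw [← smul_eq_mul, ← lintegral_smul_measure, ← S.map_dilation hμ j, lintegral_map_equiv]
  rfl

theorem integral_zpow_mul [Fact p.Prime] [CharP K p] (j : ℤ) (f : K → ℂ) :
    ∫ x, f (S.unif ^ j * x) ∂μ = (((S.q : ℝ) ^ j : ℝ) : ℂ) * ∫ x, f x ∂μ := by
  have h := integral_smul_measure (μ := μ) f (ENNReal.ofReal ((S.q : ℝ) ^ j))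
  rw [← S.map_dilation hμ j, integral_map_equiv, ENNReal.toReal_ofReal (by positivity),
    Complex.real_smul] at h
  exact h

theorem quasiMeasurePreserving_dilation [Fact p.Prime] [CharP K p] (j : ℤ) :
    Measure.QuasiMeasurePreserving (S.dilation j) μ μ :=
  ⟨(S.dilation j).measurable, by
    rw [S.map_dilation hμ j]; exact Measure.smul_absolutelyContinuous⟩

theorem measure_zpow_smul [Fact p.Prime] [CharP K p] (j : ℤ) (E : Set K) :
    μ (S.unif ^ j • E) = ENNReal.ofReal ((S.q : ℝ) ^ (-j)) * μ E := by
  rw [S.zpow_smul_eq_preimage, ← MeasurableEquiv.map_apply, S.map_dilation hμ]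
  rfl

theorem measure_closedBall_zpow [Fact p.Prime] [CharP K p] (n : ℤ) (a : K) :
    μ (closedBall a ((S.q : ℝ) ^ n)) = ENNReal.ofReal ((S.q : ℝ) ^ n) := by
  have h : closedBall (0 : K) ((S.q : ℝ) ^ n) = S.unif ^ (-n) • closedBall (0 : K) 1 := by
    ext x
    rw [S.mem_zpow_smul_iff, neg_neg, mem_closedBall, mem_closedBall, dist_zero_right,
      dist_zero_right, S.norm_zpow_mul_le_iff, mul_one]
  rw [measure_closedBall_center, h, S.measure_zpow_smul hμ, hμ, neg_neg, mul_one]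

end Scaling

/-! ### Character integrals over balls and uniqueness of the Fourier transform. -/

section Characters

variable {K : Type*} [NontriviallyNormedField K] [IsUltrametricDist K] {p c : ℕ}
  (S : AffineSetting K p c)

theorem continuous_chi_mul (ξ : K) : Continuous fun x => (S.χ (x * ξ) : ℂ) :=
  continuous_subtype_val.comp (S.χ_cont.comp (continuous_id.mul continuous_const))

theorem chi_eq_one_of_norm_le {x : K} (h : ‖x‖ ≤ 1) : (S.χ x : ℂ) = 1 := by
  rw [S.χ_integers x h, Circle.coe_one]

theorem chi_add (x y : K) : (S.χ (x + y) : ℂ) = S.χ x * S.χ y := by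
  rw [AddChar.map_add_eq_mul, Circle.coe_mul]

theorem conj_chi (x : K) : (starRingEnd ℂ) (S.χ x : ℂ) = S.χ (-x) := by
  rw [AddChar.map_neg_eq_inv, Circle.coe_inv_eq_conj]

variable [MeasurableSpace K] [BorelSpace K] [ProperSpace K] {μ : Measure K}
  [μ.IsAddHaarMeasure] (hμ : μ (closedBall (0 : K) 1) = 1)

omit [ProperSpace K] in
theorem integrable_chi_mul_iff (ξ : K) {ν : Measure K} {f : K → ℂ} :
    Integrable (fun x => (S.χ (x * ξ) : ℂ) * f x) ν ↔ Integrable f ν := by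
  have := VectorFourier.fourierIntegral_convergent_iff (μ := ν) (f := f) S.χ_cont
    (L := LinearMap.mul K K) continuous_mul (-ξ)
  simpa [Circle.smul_def] using this

include hμ

/-- For small ξ the character is constant on the ball. Otherwise some y of norm at most the radius
has `χ(yξ) ≠ 1`; translation by y preserves the ball and multiplies the integral by `χ(yξ)`, so the
integral is 0. -/
theorem setIntegral_closedBall_chi [Fact p.Prime] [CharP K p] (n : ℤ) (a ξ : K) :
    ∫ x in closedBall a ((S.q : ℝ) ^ n), (S.χ (x * ξ) : ℂ) ∂μ =
      if ‖ξ‖ ≤ (S.q : ℝ) ^ (-n) then (((S.q : ℝ) ^ n : ℝ) : ℂ) * S.χ (a * ξ) else 0 := by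
  have hq := S.q_pos
  split_ifs with h
  · have h1 : ∀ x ∈ closedBall a ((S.q : ℝ) ^ n), (S.χ (x * ξ) : ℂ) = S.χ (a * ξ) := by
      intro x hx
      rw [mem_closedBall, dist_eq_norm] at hx
      have : x * ξ = (x - a) * ξ + a * ξ := by ring
      rw [this, S.chi_add, S.chi_eq_one_of_norm_le, one_mul]
      rw [norm_mul]
      calc ‖x - a‖ * ‖ξ‖ ≤ (S.q : ℝ) ^ n * (S.q : ℝ) ^ (-n) := by gcongr
        _ = 1 := by rw [← zpow_add₀ hq.ne']; simp
    rw [setIntegral_congr_fun measurableSet_closedBall h1, setIntegral_const, Measure.real,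
      S.measure_closedBall_zpow hμ, ENNReal.toReal_ofReal (by positivity), Complex.real_smul]
  · obtain ⟨y, hy, hne⟩ := S.exists_chi_mul_ne_one (not_le.1 h)
    rw [neg_neg] at hy
    set I := ∫ x in closedBall a ((S.q : ℝ) ^ n), (S.χ (x * ξ) : ℂ) ∂μ with hI
    have h2 : I = S.χ (y * ξ) * I := by
      rw [hI, ← integral_const_mul, ← integral_indicator measurableSet_closedBall,
        ← integral_indicator measurableSet_closedBall, ← integral_add_right_eq_self _ y]
      congr 1
      ext x
      have hmem : x + y ∈ closedBall a ((S.q : ℝ) ^ n) ↔ x ∈ closedBall a ((S.q : ℝ) ^ n) := by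
        simp only [mem_closedBall, dist_eq_norm]
        constructor
        · intro h
          have := IsUltrametricDist.norm_add_le_max (x + y - a) (-y)
          rw [norm_neg, add_sub_right_comm, add_neg_cancel_right] at this
          rw [add_sub_right_comm] at h
          exact this.trans (max_le h hy)
        · intro h
          have := IsUltrametricDist.norm_add_le_max (x - a) y
          rw [add_sub_right_comm]
          exact this.trans (max_le h hy)
      by_cases hx : x ∈ closedBall a ((S.q : ℝ) ^ n)
      · rw [Set.indicator_of_mem hx, Set.indicator_of_mem (hmem.2 hx), add_mul, S.chi_add, mul_comm]
      · rw [Set.indicator_of_notMem hx, Set.indicator_of_notMem (mt hmem.1 hx)]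
    have h3 : (1 - (S.χ (y * ξ) : ℂ)) * I = 0 := by rw [sub_mul, one_mul, ← h2, sub_self]
    refine (mul_eq_zero.1 h3).resolve_left fun h4 => hne ?_
    exact Circle.coe_eq_one.1 (sub_eq_zero.1 h4).symm

omit hμ [MeasurableSpace K] [BorelSpace K] in
theorem borel_eq_generateFrom_closedBall [Fact p.Prime] :
    borel K = MeasurableSpace.generateFrom
      {s | ∃ (a : K) (n : ℤ), closedBall a ((S.q : ℝ) ^ n) = s} := by
  have hq := S.q_pos
  refine (TopologicalSpace.isTopologicalBasis_of_isOpen_of_nhds ?_ ?_).borel_eq_generateFrom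
  · rintro _ ⟨a, n, rfl⟩
    exact IsUltrametricDist.isOpen_closedBall a (by positivity)
  · intro a u ha hu
    obtain ⟨r, hr, hsub⟩ := Metric.isOpen_iff.1 hu a ha
    obtain ⟨n, hn⟩ := exists_pow_lt_of_lt_one hr (inv_lt_one_of_one_lt₀ S.one_lt_q_real)
    refine ⟨_, ⟨a, -(n : ℤ), rfl⟩, mem_closedBall_self (by positivity), ?_⟩
    refine (closedBall_subset_ball ?_).trans hsub
    rwa [zpow_neg, zpow_natCast, ← inv_pow]

/-- A character cut off to the dual ball has a multiple of the indicator of `closedBall a (q^n)` as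
its transform. The multiplication formula turns the integral of h over that ball into a pairing with
the transform of h, which is 0. -/
theorem setIntegral_closedBall_eq_zero [Fact p.Prime] [CharP K p] {h : K → ℂ} (hh : Integrable h μ)
    (h0 : ∀ ξ, ∫ x, (S.χ (x * ξ) : ℂ) * h x ∂μ = 0) (a : K) (n : ℤ) :
    ∫ x in closedBall a ((S.q : ℝ) ^ n), h x ∂μ = 0 := by
  classical
  have hq := S.q_pos
  set B := closedBall (0 : K) ((S.q : ℝ) ^ (-n)) with hB
  have hBm : MeasurableSet B := measurableSet_closedBall
  have hg : Integrable (B.indicator fun ξ => (S.χ (ξ * a) : ℂ)) μ := by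
    rw [integrable_indicator_iff hBm]
    exact (S.continuous_chi_mul a).continuousOn.integrableOn_compact (isCompact_closedBall _ _)
  have key := VectorFourier.integral_fourierIntegral_smul_eq_flip (μ := μ) (ν := μ)
    (L := LinearMap.mul K K) S.χ_cont continuous_mul hh hg
  have hl : ∀ ξ, VectorFourier.fourierIntegral S.χ μ (LinearMap.mul K K) h ξ = 0 := by
    intro ξ
    rw [← h0 (-ξ)]
    simp [VectorFourier.fourierIntegral, Circle.smul_def]
  have hr : ∀ x, VectorFourier.fourierIntegral S.χ μ (LinearMap.mul K K).flip
      (B.indicator fun ξ => (S.χ (ξ * a) : ℂ)) x =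
      (closedBall a ((S.q : ℝ) ^ n)).indicator (fun _ => (((S.q : ℝ) ^ (-n) : ℝ) : ℂ)) x := by
    intro x
    have e : VectorFourier.fourierIntegral S.χ μ (LinearMap.mul K K).flip
        (B.indicator fun ξ => (S.χ (ξ * a) : ℂ)) x = ∫ ξ in B, (S.χ (ξ * (a - x)) : ℂ) ∂μ := by
      rw [VectorFourier.fourierIntegral, ← integral_indicator hBm]
      congr 1
      ext ξ
      by_cases hξ : ξ ∈ B
      · rw [Set.indicator_of_mem hξ, Set.indicator_of_mem hξ, Circle.smul_def, smul_eq_mul,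
          ← S.chi_add]
        congr 2
        simp only [LinearMap.flip_apply, LinearMap.mul_apply']
        ring
      · rw [Set.indicator_of_notMem hξ, Set.indicator_of_notMem hξ, smul_zero]
    rw [e, S.setIntegral_closedBall_chi hμ, neg_neg, zero_mul, AddChar.map_zero_eq_one,
      Circle.coe_one, mul_one, Set.indicator_apply, mem_closedBall, dist_comm, dist_eq_norm]
  simp only [hl, hr, zero_smul, integral_zero] at key
  have : ∀ x, h x • (closedBall a ((S.q : ℝ) ^ n)).indicator
      (fun _ => (((S.q : ℝ) ^ (-n) : ℝ) : ℂ)) x =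
      (closedBall a ((S.q : ℝ) ^ n)).indicator
        (fun x => (((S.q : ℝ) ^ (-n) : ℝ) : ℂ) * h x) x := by
    intro x
    rw [Set.indicator_apply, Set.indicator_apply]
    split_ifs
    · rw [smul_eq_mul, mul_comm]
    · simp
  simp only [this] at key
  rw [integral_indicator measurableSet_closedBall, integral_const_mul] at key
  refine (mul_eq_zero.1 key.symm).resolve_left ?_
  exact_mod_cast (zpow_pos hq _).ne'

/-- An integrable function on `K` with vanishing Fourier transform vanishes. -/
theorem ae_eq_zero_of_forall_integral_chi_eq_zero [Fact p.Prime] [CharP K p] {h : K → ℂ}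
    (hh : Integrable h μ) (h0 : ∀ ξ, ∫ x, (S.χ (x * ξ) : ℂ) * h x ∂μ = 0) : h =ᵐ[μ] 0 := by
  suffices H : ∀ s, MeasurableSet s → ∫ x in s, h x ∂μ = 0 from
    hh.ae_eq_zero_of_forall_setIntegral_eq_zero fun s hs _ => H s hs
  have hball := S.setIntegral_closedBall_eq_zero hμ hh h0
  intro s hs
  induction s, hs using MeasurableSpace.induction_on_inter
    ((BorelSpace.measurable_eq (α := K)).trans S.borel_eq_generateFrom_closedBall) ?_ with
  | empty => simp
  | basic t ht =>
    obtain ⟨a, n, rfl⟩ := ht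
    exact hball a n
  | compl t ht ih =>
    have h1 := integral_add_compl ht hh
    have h2 : ∫ x, h x ∂μ = 0 := by simpa using h0 0
    rwa [h2, ih, zero_add] at h1
  | iUnion f hd hm ih => rw [integral_iUnion hm hd hh.integrableOn]; simp [ih]
  -- Ultrametric balls are nested or disjoint, so the generating balls form a π-system.
  | _ =>
    rintro _ ⟨a, n, rfl⟩ _ ⟨b, m, rfl⟩ hne
    rcases IsUltrametricDist.closedBall_subset_trichotomy a b
      ((S.q : ℝ) ^ n) ((S.q : ℝ) ^ m) with h | h | h
    · exact ⟨a, n, (Set.inter_eq_left.2 h).symm⟩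
    · exact ⟨b, m, (Set.inter_eq_right.2 h).symm⟩
    · exact absurd h.inter_eq hne.ne_empty

end Characters

/-! ### Periodization along the lattice and Fourier series on its fundamental domains. -/

section Periodization

variable {K : Type*} [NontriviallyNormedField K] [IsUltrametricDist K] {p c : ℕ}
  (S : AffineSetting K p c) [Fact p.Prime] [CharP K p]

theorem iUnion_closedBall_u : ⋃ t, closedBall (S.u t) 1 = Set.univ := by
  refine Set.eq_univ_of_forall fun x => ?_
  obtain ⟨t, ht⟩ := S.exists_norm_sub_u_le x
  exact Set.mem_iUnion.2 ⟨t, by rwa [mem_closedBall, dist_eq_norm]⟩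

theorem eq_of_norm_sub_u_le {x : K} {s t : ℕ} (hs : ‖x - S.u s‖ ≤ 1) (ht : ‖x - S.u t‖ ≤ 1) :
    s = t := by
  apply S.eq_of_norm_u_sub_le
  have := IsUltrametricDist.norm_add_le_max (x - S.u t) (-(x - S.u s))
  rw [norm_neg] at this
  have e : x - S.u t + -(x - S.u s) = S.u s - S.u t := by ring
  rw [e] at this
  exact this.trans (max_le ht hs)

theorem pairwise_disjoint_closedBall_u :
    Pairwise (Function.onFun Disjoint fun t => closedBall (S.u t) 1) := by
  intro s t hst
  rw [Function.onFun, Set.disjoint_left]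
  intro x hs ht
  rw [mem_closedBall, dist_eq_norm] at hs ht
  exact hst (S.eq_of_norm_sub_u_le hs ht)

theorem eq_zero_of_mem_lattice_of_norm_le {l : K} (hl : l ∈ S.lattice) (h : ‖l‖ ≤ 1) : l = 0 := by
  obtain ⟨t, rfl⟩ := hl
  rw [← S.u_zero]
  congr 1
  exact S.eq_of_norm_u_sub_le (by rwa [S.u_zero, sub_zero])

theorem existsUnique_norm_add_u_le (x : K) : ∃! t, ‖x + S.u t‖ ≤ 1 := by
  obtain ⟨t, ht⟩ := S.exists_norm_sub_u_le (-x)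
  have e : ∀ s, ‖x + S.u s‖ = ‖-x - S.u s‖ := fun s => by
    rw [← norm_neg]; congr 1; ring
  refine ⟨t, by simpa only [e] using ht, fun s hs => ?_⟩
  simp only [e] at hs
  exact S.eq_of_norm_sub_u_le hs ht

omit [IsUltrametricDist K] in
theorem indicator_closedBall_add {M : Type*} [Zero M] (f : K → M) (a ξ : K) :
    (closedBall (0 : K) 1).indicator (fun ξ => f (ξ + a)) ξ =
      (closedBall a 1).indicator f (ξ + a) := by
  classical
  simp [Set.indicator_apply, dist_eq_norm]

theorem chi_add_u_mul {l : K} (hl : l ∈ S.lattice) (ξ : K) (t : ℕ) :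
    (S.χ ((ξ + S.u t) * l) : ℂ) = S.χ (ξ * l) := by
  rw [add_mul, S.chi_add, S.chi_mul_of_mem_lattice (S.u_mem_lattice t) hl, Circle.coe_one, mul_one]

variable [MeasurableSpace K] [BorelSpace K] {μ : Measure K} [μ.IsAddHaarMeasure]

omit [IsUltrametricDist K] in
theorem setLIntegral_add_right (f : K → ℝ≥0∞) (a : K) :
    ∫⁻ ξ in closedBall (0 : K) 1, f (ξ + a) ∂μ = ∫⁻ ξ in closedBall a 1, f ξ ∂μ := by
  rw [← lintegral_indicator measurableSet_closedBall, ← lintegral_indicator measurableSet_closedBall,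
    ← lintegral_add_right_eq_self ((closedBall a 1).indicator f) a]
  simp only [indicator_closedBall_add]

omit [IsUltrametricDist K] in
theorem setIntegral_add_right (f : K → ℂ) (a : K) :
    ∫ ξ in closedBall (0 : K) 1, f (ξ + a) ∂μ = ∫ ξ in closedBall a 1, f ξ ∂μ := by
  rw [← integral_indicator measurableSet_closedBall, ← integral_indicator measurableSet_closedBall,
    ← integral_add_right_eq_self ((closedBall a 1).indicator f) a]
  simp only [indicator_closedBall_add]

theorem tsum_setLIntegral_add_u (f : K → ℝ≥0∞) :
    ∑' t, ∫⁻ ξ in closedBall (0 : K) 1, f (ξ + S.u t) ∂μ = ∫⁻ ξ, f ξ ∂μ := by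
  simp only [setLIntegral_add_right]
  rw [← lintegral_iUnion (fun _ => measurableSet_closedBall) S.pairwise_disjoint_closedBall_u,
    S.iUnion_closedBall_u, setLIntegral_univ]

theorem tsum_setIntegral_add_u {f : K → ℂ} (hf : Integrable f μ) :
    ∑' t, ∫ ξ in closedBall (0 : K) 1, f (ξ + S.u t) ∂μ = ∫ ξ, f ξ ∂μ := by
  simp only [setIntegral_add_right]
  rw [← integral_iUnion (fun _ => measurableSet_closedBall) S.pairwise_disjoint_closedBall_u
    hf.integrableOn, S.iUnion_closedBall_u, setIntegral_univ]

/-- Countably many lattice translates of 𝔇 cover K, so null sets can be tested on 𝔇 after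
translation. -/
theorem ae_of_forall_ae_closedBall {P : K → Prop}
    (h : ∀ s, ∀ᵐ ξ ∂μ.restrict (closedBall 0 1), P (ξ + S.u s)) : ∀ᵐ ξ ∂μ, P ξ := by
  have h1 : ∀ s, ∀ᵐ ξ ∂μ, ξ ∈ closedBall (S.u s) 1 → P ξ := by
    intro s
    have h2 := (ae_restrict_iff' measurableSet_closedBall).1 (h s)
    have h3 := (measurePreserving_add_right μ (-S.u s)).quasiMeasurePreserving.ae h2
    filter_upwards [h3] with ξ hξ hm
    have := hξ (by simpa [dist_eq_norm, sub_eq_add_neg] using hm)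
    simpa using this
  filter_upwards [ae_all_iff.2 h1] with ξ hξ
  obtain ⟨t, ht⟩ := S.exists_norm_sub_u_le ξ
  exact hξ t (by rwa [mem_closedBall, dist_eq_norm])

omit [Fact p.Prime] [CharP K p] in
theorem aestronglyMeasurable_add_u {f : K → ℂ} (hf : Integrable f μ) (t : ℕ) :
    AEStronglyMeasurable (fun ξ => f (ξ + S.u t)) (μ.restrict (closedBall 0 1)) :=
  (hf.comp_add_right (S.u t)).aestronglyMeasurable.restrict

theorem tsum_setLIntegral_enorm_ne_top {f : K → ℂ} (hf : Integrable f μ) :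
    ∑' t, ∫⁻ ξ in closedBall (0 : K) 1, ‖f (ξ + S.u t)‖ₑ ∂μ ≠ ∞ := by
  rw [S.tsum_setLIntegral_add_u fun ξ => ‖f ξ‖ₑ]
  exact hf.2.ne

theorem setLIntegral_tsum_enorm_ne_top {f : K → ℂ} (hf : Integrable f μ) :
    ∫⁻ ξ in closedBall (0 : K) 1, ∑' t, ‖f (ξ + S.u t)‖ₑ ∂μ ≠ ∞ := by
  rw [lintegral_tsum fun t => (S.aestronglyMeasurable_add_u hf t).enorm]
  exact S.tsum_setLIntegral_enorm_ne_top hf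

theorem ae_closedBall_summable_add_u {f : K → ℂ} (hf : Integrable f μ) :
    ∀ᵐ ξ ∂μ.restrict (closedBall 0 1), Summable fun t => f (ξ + S.u t) := by
  filter_upwards [ae_lt_top' (AEMeasurable.tsum fun t =>
    (S.aestronglyMeasurable_add_u hf t).enorm) (S.setLIntegral_tsum_enorm_ne_top hf)] with ξ hξ
  exact Summable.of_enorm hξ.ne

theorem ae_summable_add_u {f : K → ℂ} (hf : Integrable f μ) :
    ∀ᵐ ξ ∂μ, Summable fun t => f (ξ + S.u t) := by
  refine S.ae_of_forall_ae_closedBall fun s => ?_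
  have := S.ae_closedBall_summable_add_u (hf.comp_add_right (S.u s))
  simpa only [add_right_comm] using this

theorem integrableOn_tsum_add_u {f : K → ℂ} (hf : Integrable f μ) :
    IntegrableOn (fun ξ => ∑' t, f (ξ + S.u t)) (closedBall 0 1) μ := by
  refine ⟨?_, ?_⟩
  · refine aestronglyMeasurable_of_tendsto_ae atTop
      (f := fun n ξ => ∑ t ∈ Finset.range n, f (ξ + S.u t)) (fun n => ?_) ?_
    · exact Finset.aestronglyMeasurable_fun_sum _ fun t _ => S.aestronglyMeasurable_add_u hf t
    · filter_upwards [S.ae_closedBall_summable_add_u hf] with ξ hξ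
      exact hξ.hasSum.tendsto_sum_nat
  · refine lt_of_le_of_lt (lintegral_mono fun ξ => enorm_tsum_le_tsum_enorm)
      (S.setLIntegral_tsum_enorm_ne_top hf).lt_top

theorem setIntegral_tsum_add_u {f : K → ℂ} (hf : Integrable f μ) :
    ∫ ξ in closedBall (0 : K) 1, ∑' t, f (ξ + S.u t) ∂μ = ∫ ξ, f ξ ∂μ := by
  rw [integral_tsum (fun t => S.aestronglyMeasurable_add_u hf t)
    (S.tsum_setLIntegral_enorm_ne_top hf), S.tsum_setIntegral_add_u hf]

variable [ProperSpace K] (hμ : μ (closedBall (0 : K) 1) = 1)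

include hμ

theorem ae_closedBall_tsum_add_u_eq_zero {f : K → ℂ} (hf : Integrable f μ)
    (h0 : ∀ l ∈ S.lattice, ∫ x, (S.χ (x * l) : ℂ) * f x ∂μ = 0) :
    ∀ᵐ ξ ∂μ.restrict (closedBall 0 1), ∑' t, f (ξ + S.u t) = 0 := by
  have hD : MeasurableSet (closedBall (0 : K) 1) := measurableSet_closedBall
  have hi := S.integrableOn_tsum_add_u hf
  have key := S.ae_eq_zero_of_forall_integral_chi_eq_zero hμ ((integrable_indicator_iff hD).2 hi) ?_
  · rw [ae_restrict_iff' hD]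
    filter_upwards [key] with ξ hξ hm
    rwa [Set.indicator_of_mem hm] at hξ
  · intro ξ
    -- On 𝔇 the character of an arbitrary frequency ξ agrees with that of the lattice point nearest
    -- to it, so vanishing at lattice frequencies gives a transform that vanishes everywhere.
    obtain ⟨t, ht⟩ := S.exists_norm_sub_u_le ξ
    have hl := S.u_mem_lattice t
    rw [← h0 _ hl, ← S.setIntegral_tsum_add_u ((S.integrable_chi_mul_iff _).2 hf),
      ← integral_indicator hD]
    congr 1
    ext x
    by_cases hx : x ∈ closedBall (0 : K) 1
    · rw [Set.indicator_of_mem hx, Set.indicator_of_mem hx, ← tsum_mul_left]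
      congr 1
      ext s
      rw [S.chi_add_u_mul hl]
      have e : x * ξ = x * (ξ - S.u t) + x * S.u t := by ring
      rw [e, S.chi_add, S.chi_eq_one_of_norm_le, one_mul]
      rw [mem_closedBall, dist_zero_right] at hx
      rw [norm_mul]
      exact mul_le_one₀ hx (norm_nonneg _) ht
    · rw [Set.indicator_of_notMem hx, Set.indicator_of_notMem hx, mul_zero]

/-- The periodization of an integrable function all of whose Fourier coefficients along the
lattice vanish is zero. -/
theorem ae_tsum_add_u_eq_zero {f : K → ℂ} (hf : Integrable f μ)
    (h0 : ∀ l ∈ S.lattice, ∫ x, (S.χ (x * l) : ℂ) * f x ∂μ = 0) :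
    ∀ᵐ ξ ∂μ, ∑' t, f (ξ + S.u t) = 0 := by
  refine S.ae_of_forall_ae_closedBall fun s => ?_
  have := S.ae_closedBall_tsum_add_u_eq_zero hμ (hf.comp_add_right (S.u s)) ?_
  · simpa only [add_right_comm] using this
  · intro l hl
    rw [← h0 l hl, ← integral_add_right_eq_self (fun x => (S.χ (x * l) : ℂ) * f x) (S.u s)]
    simp only [S.chi_add_u_mul hl]

/-- The characters indexed by the lattice are complete on a fundamental domain of the lattice. -/
theorem ae_eq_zero_of_tsum_indicator_eq_one {A : Set K} (hA : MeasurableSet A)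
    (hS : ∀ᵐ ξ ∂μ, ∑' t, A.indicator (fun _ => (1 : ℝ≥0∞)) (ξ + S.u t) = 1)
    {f : K → ℂ} (hf : IntegrableOn f A μ)
    (h0 : ∀ l ∈ S.lattice, ∫ x in A, (S.χ (x * l) : ℂ) * f x ∂μ = 0) :
    ∀ᵐ ξ ∂μ, ξ ∈ A → f ξ = 0 := by
  have key := S.ae_tsum_add_u_eq_zero hμ ((integrable_indicator_iff hA).2 hf) fun l hl => by
    rw [← h0 l hl, ← integral_indicator hA]
    congr 1
    ext x
    rw [Set.indicator_mul_right]
  filter_upwards [key, hS] with ξ h1 h2 hm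
  -- Multiplicity one means that no other translate of ξ lies in A, so the vanishing periodization
  -- reduces to `f ξ`.
  rw [tsum_eq_single 0, S.u_zero, add_zero, Set.indicator_of_mem hm] at h1
  · exact h1
  · intro t ht
    refine Set.indicator_of_notMem (fun hmem => ?_) _
    have h3 := ENNReal.sum_le_tsum (f := fun t => A.indicator (fun _ => (1 : ℝ≥0∞)) (ξ + S.u t))
      {0, t}
    rw [h2, Finset.sum_pair ht.symm] at h3
    simp only [S.u_zero, add_zero] at h3
    rw [Set.indicator_of_mem hm, Set.indicator_of_mem hmem] at h3
    norm_num at h3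

theorem setIntegral_closedBall_one_chi {l : K} (hl : l ∈ S.lattice) [Decidable (l = 0)] (a : K) :
    ∫ x in closedBall a 1, (S.χ (x * l) : ℂ) ∂μ = if l = 0 then 1 else 0 := by
  have := S.setIntegral_closedBall_chi hμ 0 a l
  rw [zpow_zero] at this
  rw [this]
  by_cases h : l = 0
  · simp [h]
  · rw [if_neg h, if_neg]
    rw [neg_zero, zpow_zero]
    exact fun h' => h (S.eq_zero_of_mem_lattice_of_norm_le hl h')

omit hμ [IsUltrametricDist K] [NontriviallyNormedField K] [MeasurableSpace K] [BorelSpace K]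
  [ProperSpace K] [CharP K p] in
-- Summability is essential here: a divergent complex sum has default value 0, whereas the sum in
-- `[0, ∞]` is infinite.
theorem tsum_indicator_eq_natCast {X : Type*} {A : Set X} {v : ℕ → X} {n : ℕ}
    (hs : Summable fun t => A.indicator (fun _ => (1 : ℂ)) (v t))
    (h : ∑' t, A.indicator (fun _ => (1 : ℂ)) (v t) = n) :
    ∑' t, A.indicator (fun _ => (1 : ℝ≥0∞)) (v t) = n := by
  classical
  have e : ∀ x, A.indicator (fun _ => (1 : ℂ)) x = ((A.indicator (fun _ => (1 : ℝ)) x : ℝ) : ℂ) := by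
    intro x
    simp only [Set.indicator_apply]
    split_ifs <;> simp
  have e' : ∀ x, A.indicator (fun _ => (1 : ℝ≥0∞)) x =
      ENNReal.ofReal (A.indicator (fun _ => (1 : ℝ)) x) := by
    intro x
    simp only [Set.indicator_apply]
    split_ifs <;> simp
  simp only [e] at hs h
  rw [← Complex.ofReal_tsum] at h
  simp only [e']
  rw [← ENNReal.ofReal_tsum_of_nonneg
    (fun t => Set.indicator_nonneg (fun _ _ => zero_le_one) _) (Complex.summable_ofReal.1 hs)]
  have h' : ∑' t, A.indicator (fun _ => (1 : ℝ)) (v t) = n := by exact_mod_cast h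
  rw [h', ENNReal.ofReal_natCast]

/-- The function `n · 1_𝔇` has the same lattice coefficients and a periodization constantly equal to
n, so the difference periodizes to 0. -/
theorem ae_tsum_indicator_eq_of_setIntegral_chi {A : Set K} (hA : MeasurableSet A)
    (hfin : μ A ≠ ∞) {n : ℕ} (h0 : ∀ l ∈ S.lattice, l ≠ 0 → ∫ x in A, (S.χ (x * l) : ℂ) ∂μ = 0)
    (h1 : ∫ x in A, (S.χ (x * 0) : ℂ) ∂μ = n) :
    ∀ᵐ ξ ∂μ, ∑' t, A.indicator (fun _ => (1 : ℝ≥0∞)) (ξ + S.u t) = n := by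
  classical
  have hD : MeasurableSet (closedBall (0 : K) 1) := measurableSet_closedBall
  have hAi : Integrable (A.indicator fun _ => (1 : ℂ)) μ :=
    (integrable_indicator_iff hA).2 (integrableOn_const hfin)
  have hDi : Integrable ((closedBall (0 : K) 1).indicator fun _ => (n : ℂ)) μ :=
    (integrable_indicator_iff hD).2 (integrableOn_const (by rw [hμ]; exact ENNReal.one_ne_top))
  have hind : ∀ (B : Set K) (a : ℂ) (l : K), MeasurableSet B →
      ∫ x, (S.χ (x * l) : ℂ) * B.indicator (fun _ => a) x ∂μ =
        (∫ x in B, (S.χ (x * l) : ℂ) ∂μ) * a := by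
    intro B a l hB
    rw [← integral_mul_const, ← integral_indicator hB]
    congr 1
    ext x
    by_cases hx : x ∈ B <;> simp [hx]
  have key := S.ae_tsum_add_u_eq_zero hμ (hAi.sub hDi) fun l hl => by
    simp only [Pi.sub_apply, mul_sub]
    rw [integral_sub ((S.integrable_chi_mul_iff l).2 hAi) ((S.integrable_chi_mul_iff l).2 hDi),
      hind _ _ _ hA, hind _ _ _ hD, S.setIntegral_closedBall_one_chi hμ hl]
    by_cases h : l = 0
    · subst h
      rw [h1]; simp
    · rw [h0 l hl h, if_neg h]; simp
  filter_upwards [key, S.ae_summable_add_u hAi] with ξ hξ hs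
  refine tsum_indicator_eq_natCast hs ?_
  obtain ⟨t, ht, huniq⟩ := S.existsUnique_norm_add_u_le ξ
  have hsum : HasSum (fun t => (closedBall (0 : K) 1).indicator (fun _ => (n : ℂ)) (ξ + S.u t)) n := by
    convert hasSum_single t ?_ using 1
    · rw [Set.indicator_of_mem]
      rwa [mem_closedBall, dist_zero_right]
    · intro s hs
      refine Set.indicator_of_notMem (fun hm => hs (huniq s ?_)) _
      rwa [mem_closedBall, dist_zero_right] at hm
  simp only [Pi.sub_apply] at hξ
  rw [hs.tsum_sub hsum.summable, hsum.tsum_eq, sub_eq_zero] at hξ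
  exact hξ

omit hμ [ProperSpace K] in
theorem measure_of_ae_tsum_indicator_eq (hμ : μ (closedBall (0 : K) 1) = 1) {A : Set K}
    (hA : MeasurableSet A) {n : ℕ}
    (h : ∀ᵐ ξ ∂μ, ∑' t, A.indicator (fun _ => (1 : ℝ≥0∞)) (ξ + S.u t) = n) : μ A = n := by
  have h1 := S.tsum_setLIntegral_add_u (μ := μ) (A.indicator fun _ => (1 : ℝ≥0∞))
  rw [← lintegral_tsum, lintegral_congr_ae (ae_restrict_of_ae h), lintegral_indicator hA] at h1
  · simpa [hμ] using h1.symm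
  · intro t
    exact ((measurable_const.indicator hA).comp (measurable_add_const _)).aemeasurable

/-- Lattice characters are Λ-periodic, so the integral over A folds to n times the integral of the
character over 𝔇. -/
theorem setIntegral_chi_of_ae_tsum_indicator_eq {A : Set K} (hA : MeasurableSet A) {n : ℕ}
    (h : ∀ᵐ ξ ∂μ, ∑' t, A.indicator (fun _ => (1 : ℝ≥0∞)) (ξ + S.u t) = n)
    {l : K} (hl : l ∈ S.lattice) [Decidable (l = 0)] :
    ∫ x in A, (S.χ (x * l) : ℂ) ∂μ = if l = 0 then (n : ℂ) else 0 := by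
  classical
  have hAi : Integrable (A.indicator fun _ => (1 : ℂ)) μ :=
    (integrable_indicator_iff hA).2 (integrableOn_const (by
      rw [S.measure_of_ae_tsum_indicator_eq hμ hA h]; exact ENNReal.natCast_ne_top n))
  have h1 := S.setIntegral_tsum_add_u ((S.integrable_chi_mul_iff l).2 hAi)
  have h2 : ∫ x, (S.χ (x * l) : ℂ) * A.indicator (fun _ => (1 : ℂ)) x ∂μ =
      ∫ x in A, (S.χ (x * l) : ℂ) ∂μ := by
    rw [← integral_indicator hA]
    congr 1
    ext x
    by_cases hx : x ∈ A <;> simp [hx]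
  have h3 : ∀ᵐ ξ ∂μ.restrict (closedBall 0 1),
      ∑' t, (S.χ ((ξ + S.u t) * l) : ℂ) * A.indicator (fun _ => (1 : ℂ)) (ξ + S.u t) =
        (S.χ (ξ * l) : ℂ) * n := by
    filter_upwards [ae_restrict_of_ae h] with ξ hξ
    simp only [S.chi_add_u_mul hl]
    rw [tsum_mul_left]
    congr 1
    have e : ∀ t, A.indicator (fun _ => (1 : ℂ)) (ξ + S.u t) =
        ((A.indicator (fun _ => (1 : ℝ≥0∞)) (ξ + S.u t)).toReal : ℂ) := by
      intro t
      simp only [Set.indicator_apply]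
      split_ifs <;> simp
    simp only [e]
    rw [← Complex.ofReal_tsum, ← ENNReal.tsum_toReal_eq, hξ]
    · simp
    · intro t
      simp only [Set.indicator_apply]
      split_ifs <;> simp
  rw [integral_congr_ae h3, integral_mul_const, S.setIntegral_closedBall_one_chi hμ hl, h2] at h1
  rw [← h1]
  split_ifs <;> simp

end Periodization

/-! ### Hilbert bases as orthonormal families with trivial orthogonal complement. -/

section HilbertBasisCriterion

theorem exists_hilbertBasis_iff {ι E : Type*} [NormedAddCommGroup E] [InnerProductSpace ℂ E]
    [CompleteSpace E] (v : ι → E) :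
    (∃ b : HilbertBasis ι ℂ E, ∀ i, b i = v i) ↔
      Orthonormal ℂ v ∧ ∀ f : E, (∀ i, inner ℂ (v i) f = 0) → f = 0 := by
  constructor
  · rintro ⟨b, hb⟩
    have hbv : ⇑b = v := funext hb
    refine ⟨hbv ▸ b.orthonormal, fun f hf => ?_⟩
    apply b.repr.injective
    ext i
    rw [HilbertBasis.repr_apply_apply, hb, hf, map_zero]
    rfl
  · rintro ⟨ho, hc⟩
    have hbot : (Submodule.span ℂ (Set.range v))ᗮ = ⊥ := by
      rw [Submodule.eq_bot_iff]
      intro f hf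
      exact hc f fun i => hf _ (Submodule.subset_span ⟨i, rfl⟩)
    exact ⟨HilbertBasis.mkOfOrthogonalEqBot ho hbot, fun i => by
      rw [HilbertBasis.coe_mkOfOrthogonalEqBot]⟩

theorem inner_toLp {X : Type*} [MeasurableSpace X] {μ : Measure X} {f : X → ℂ}
    (hf : MemLp f 2 μ) (g : Lp ℂ 2 μ) :
    inner ℂ (hf.toLp f) g = ∫ x, (starRingEnd ℂ) (f x) * g x ∂μ := by
  rw [L2.inner_def]
  refine integral_congr_ae ?_
  filter_upwards [hf.coeFn_toLp] with x hx
  rw [hx, RCLike.inner_apply, mul_comm]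

end HilbertBasisCriterion

/-! ### Gabor bases attached to the lattice. -/

section Gabor

variable {K : Type*} [NontriviallyNormedField K] [IsUltrametricDist K] {p c : ℕ}
  (S : AffineSetting K p c) [MeasurableSpace K] [BorelSpace K]
  {μ : Measure K} [μ.IsAddHaarMeasure]

/-- The character `x ↦ χ(xl)` restricted to the set `A`. -/
noncomputable def modIndicator (A : Set K) (l : K) : K → ℂ :=
  A.indicator fun x => (S.χ (x * l) : ℂ)

omit [μ.IsAddHaarMeasure] in
theorem memLp_modIndicator [SecondCountableTopology K] {A : Set K} (hA : MeasurableSet A)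
    (hfin : μ A ≠ ∞) (l : K) :
    MemLp (S.modIndicator A l) 2 μ := by
  refine (memLp_indicator_const 2 hA (1 : ℂ) (Or.inr hfin)).mono ?_ ?_
  · exact ((S.continuous_chi_mul l).measurable.indicator hA).aestronglyMeasurable
  · refine Eventually.of_forall fun x => ?_
    by_cases hx : x ∈ A
    · simp only [modIndicator, Set.indicator_of_mem hx]
      rw [Circle.norm_coe, norm_one]
    · simp [modIndicator, hx]

omit [BorelSpace K] [μ.IsAddHaarMeasure] in
theorem integral_conj_modIndicator_mul {A : Set K} (hA : MeasurableSet A) (l : K) (g : K → ℂ) :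
    ∫ x, (starRingEnd ℂ) (S.modIndicator A l x) * g x ∂μ =
      ∫ x in A, (S.χ (x * -l) : ℂ) * g x ∂μ := by
  rw [← integral_indicator hA]
  congr 1
  ext x
  by_cases hx : x ∈ A
  · simp only [modIndicator, Set.indicator_of_mem hx, S.conj_chi, mul_neg]
  · simp [modIndicator, hx]

omit [μ.IsAddHaarMeasure] in
theorem inner_toLp_modIndicator [SecondCountableTopology K] {A : Set K} (hA : MeasurableSet A)
    (hfin : μ A ≠ ∞) (l : K) (g : Lp ℂ 2 μ) :
    inner ℂ ((S.memLp_modIndicator hA hfin l).toLp _) g =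
      ∫ x in A, (S.χ (x * -l) : ℂ) * g x ∂μ := by
  rw [inner_toLp, S.integral_conj_modIndicator_mul hA]

omit [NontriviallyNormedField K] [IsUltrametricDist K] [BorelSpace K] [μ.IsAddHaarMeasure] in
theorem integrableOn_of_lp {A : Set K} (hfin : μ A ≠ ∞) (g : Lp ℂ 2 μ) : IntegrableOn g A μ := by
  have : IsFiniteMeasure (μ.restrict A) := isFiniteMeasure_restrict.2 hfin
  exact ((Lp.memLp g).restrict A).integrable one_le_two

section Proper

variable [ProperSpace K]

omit [IsUltrametricDist K] [BorelSpace K] in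
theorem measure_closedBall_ne_top (a : K) : μ (closedBall a 1) ≠ ∞ :=
  (isCompact_closedBall a 1).measure_lt_top.ne

/-- The Gabor functions `χ(xl) 1_{a+𝔇}`. -/
noncomputable def gabor (μ : Measure K) [μ.IsAddHaarMeasure] (a l : K) : Lp ℂ 2 μ :=
  (S.memLp_modIndicator (μ := μ) measurableSet_closedBall (measure_closedBall_ne_top a) l).toLp _

theorem inner_gabor (a l : K) (g : Lp ℂ 2 μ) :
    inner ℂ (S.gabor μ a l) g = ∫ x in closedBall a 1, (S.χ (x * -l) : ℂ) * g x ∂μ :=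
  S.inner_toLp_modIndicator measurableSet_closedBall (measure_closedBall_ne_top a) l g

end Proper

variable [Fact p.Prime] [CharP K p]

omit [MeasurableSpace K] [BorelSpace K] in
theorem tsum_indicator_closedBall (a ξ : K) :
    ∑' t, (closedBall a 1).indicator (fun _ => (1 : ℝ≥0∞)) (ξ + S.u t) = 1 := by
  obtain ⟨t, ht, huniq⟩ := S.existsUnique_norm_add_u_le (ξ - a)
  have e : ∀ s, ξ + S.u s ∈ closedBall a 1 ↔ ‖ξ - a + S.u s‖ ≤ 1 := fun s => by
    rw [mem_closedBall, dist_eq_norm, add_sub_right_comm]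
  rw [tsum_eq_single t, Set.indicator_of_mem ((e t).2 ht)]
  intro s hs
  exact Set.indicator_of_notMem (fun h => hs (huniq s ((e s).1 h))) _

variable [ProperSpace K] (hμ : μ (closedBall (0 : K) 1) = 1)

include hμ

theorem ae_eq_zero_of_forall_setIntegral_closedBall_u {f : K → ℂ}
    (hf : ∀ s, IntegrableOn f (closedBall (S.u s) 1) μ)
    (h0 : ∀ s, ∀ l ∈ S.lattice, ∫ x in closedBall (S.u s) 1, (S.χ (x * l) : ℂ) * f x ∂μ = 0) :
    f =ᵐ[μ] 0 := by
  have h : ∀ s, ∀ᵐ ξ ∂μ, ξ ∈ closedBall (S.u s) 1 → f ξ = 0 := fun s =>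
    S.ae_eq_zero_of_tsum_indicator_eq_one hμ measurableSet_closedBall
      (Eventually.of_forall (S.tsum_indicator_closedBall _)) (hf s) (h0 s)
  filter_upwards [ae_all_iff.2 h] with ξ hξ
  obtain ⟨t, ht⟩ := S.exists_norm_sub_u_le ξ
  exact hξ t (by rwa [mem_closedBall, dist_eq_norm])

/-- Different cells are disjoint, and on one cell the lattice characters are orthonormal and
complete. The free indexing by `i` and `v` allows two enumerations with space and frequency
exchanged. -/
theorem exists_hilbertBasis_gabor {ι : Type*} (i : ι → ℕ) (v : ι → K)
    (hinj : ∀ x y, i x = i y → v x = v y → x = y) (hv : ∀ x, v x ∈ S.lattice)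
    (hsurj : ∀ t, ∀ l ∈ S.lattice, ∃ x, i x = t ∧ v x = l) :
    ∃ b : HilbertBasis ι ℂ (Lp ℂ 2 μ), ∀ x, b x = S.gabor μ (S.u (i x)) (v x) := by
  classical
  rw [exists_hilbertBasis_iff]
  constructor
  · rw [orthonormal_iff_ite]
    intro x y
    rw [S.inner_gabor, gabor]
    have h1 : ∫ z in closedBall (S.u (i x)) 1, (S.χ (z * -v x) : ℂ) *
        ((S.memLp_modIndicator (μ := μ) measurableSet_closedBall
          (measure_closedBall_ne_top (S.u (i y))) (v y)).toLp _) z ∂μ =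
        ∫ z in closedBall (S.u (i x)) 1, (S.χ (z * -v x) : ℂ) *
          S.modIndicator (closedBall (S.u (i y)) 1) (v y) z ∂μ := by
      refine integral_congr_ae (ae_restrict_of_ae ?_)
      filter_upwards [MemLp.coeFn_toLp (S.memLp_modIndicator (μ := μ) measurableSet_closedBall
          (measure_closedBall_ne_top (S.u (i y))) (v y))] with z hz
      rw [hz]
    rw [h1]
    by_cases hi : i x = i y
    · rw [← hi]
      have h2 : ∀ z ∈ closedBall (S.u (i x)) 1, (S.χ (z * -v x) : ℂ) *
          S.modIndicator (closedBall (S.u (i x)) 1) (v y) z = S.χ (z * (v y - v x)) := by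
        intro z hz
        rw [modIndicator, Set.indicator_of_mem hz, ← S.chi_add]
        congr 2
        ring
      rw [setIntegral_congr_fun measurableSet_closedBall h2,
        S.setIntegral_closedBall_one_chi hμ (sub_mem (hv y) (hv x))]
      refine if_congr ?_ rfl rfl
      rw [sub_eq_zero]
      exact ⟨fun h => hinj _ _ hi h.symm, fun h => by rw [h]⟩
    · rw [if_neg fun h => hi (congrArg i h)]
      refine setIntegral_eq_zero_of_forall_eq_zero fun z hz => ?_
      rw [modIndicator, Set.indicator_of_notMem, mul_zero]
      exact Set.disjoint_left.1 (S.pairwise_disjoint_closedBall_u hi) hz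
  · intro f hf
    rw [Lp.eq_zero_iff_ae_eq_zero]
    refine S.ae_eq_zero_of_forall_setIntegral_closedBall_u hμ
      (fun s => integrableOn_of_lp (measure_closedBall_ne_top _) f) fun s l hl => ?_
    obtain ⟨x, hx1, hx2⟩ := hsurj s (-l) (neg_mem hl)
    have := hf x
    rwa [S.inner_gabor, hx1, hx2, neg_neg] at this

/-- Formally, `χ(x u(s)) 1_{l+𝔇}` has Fourier transform `χ(-ξl) 1_{u(s)+𝔇}`, the factor `χ(l u(s))`
being 1. The isometry is defined by carrying the first orthonormal basis to the second. -/
theorem exists_fourier_isometry :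
    ∃ U : Lp ℂ 2 μ ≃ₗᵢ[ℂ] Lp ℂ 2 μ, ∀ (s : ℕ), ∀ l ∈ S.lattice, ∀ f : Lp ℂ 2 μ,
      inner ℂ (S.gabor μ (S.u s) (-l)) (U f) = inner ℂ (S.gabor μ l (S.u s)) f := by
  obtain ⟨b, hb⟩ := S.exists_hilbertBasis_gabor hμ (ι := ℕ × ℕ) (fun x => x.2) (fun x => S.u x.1)
    (fun x y h1 h2 => Prod.ext (S.u_injective h2) h1) (fun x => S.u_mem_lattice _) (by
      rintro t _ ⟨s, rfl⟩
      exact ⟨(s, t), rfl, rfl⟩)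
  obtain ⟨b', hb'⟩ := S.exists_hilbertBasis_gabor hμ (ι := ℕ × ℕ) (fun x => x.1)
    (fun x => -S.u x.2)
    (fun x y h1 h2 => Prod.ext h1 (S.u_injective (neg_injective h2)))
    (fun x => neg_mem (S.u_mem_lattice _)) (by
      intro t l hl
      obtain ⟨s, hs⟩ := neg_mem hl
      exact ⟨(t, s), rfl, by rw [hs, neg_neg]⟩)
  refine ⟨b.repr.trans b'.repr.symm, ?_⟩
  rintro s _ ⟨t, rfl⟩ f
  rw [← hb' (s, t), ← hb (s, t), ← HilbertBasis.repr_apply_apply, ← HilbertBasis.repr_apply_apply]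
  simp

end Gabor

/-! ### Agreement of the unitary map with the Fourier integral. -/

section FourierL2

variable {K : Type*} [NontriviallyNormedField K] [IsUltrametricDist K] {p c : ℕ}
  (S : AffineSetting K p c) [MeasurableSpace K] [BorelSpace K]
  {μ : Measure K} [μ.IsAddHaarMeasure] [Fact p.Prime] [CharP K p]
  [ProperSpace K] (hμ : μ (closedBall (0 : K) 1) = 1)

/-- The Fourier transform on `L²(K)`. -/
noncomputable def fourierL2 : Lp ℂ 2 μ ≃ₗᵢ[ℂ] Lp ℂ 2 μ := (S.exists_fourier_isometry hμ).choose

theorem inner_gabor_fourierL2 (s : ℕ) {l : K} (hl : l ∈ S.lattice) (f : Lp ℂ 2 μ) :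
    inner ℂ (S.gabor μ (S.u s) (-l)) (S.fourierL2 hμ f) = inner ℂ (S.gabor μ l (S.u s)) f :=
  (S.exists_fourier_isometry hμ).choose_spec s l hl f

omit [μ.IsAddHaarMeasure] [Fact p.Prime] [CharP K p] [ProperSpace K] in
theorem continuous_fourierIntegral {f : K → ℂ} (hf : Integrable f μ) :
    Continuous (Fourier.fourierIntegral S.χ μ f) :=
  VectorFourier.fourierIntegral_continuous S.χ_cont (L := LinearMap.mul K K) continuous_mul hf

include hμ

/-- By the multiplication formula, the Fourier integral satisfies the relation that characterizes
the unitary map on Gabor functions. -/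
theorem setIntegral_chi_mul_fourierIntegral {f : K → ℂ} (hf : Integrable f μ) (s : ℕ) {l : K}
    (hl : l ∈ S.lattice) :
    ∫ ξ in closedBall (S.u s) 1, (S.χ (ξ * l) : ℂ) * Fourier.fourierIntegral S.χ μ f ξ ∂μ =
      ∫ x in closedBall l 1, (S.χ (x * -S.u s) : ℂ) * f x ∂μ := by
  classical
  set B := closedBall (S.u s) 1 with hB
  have hBm : MeasurableSet B := measurableSet_closedBall
  have hg : Integrable (S.modIndicator B l) μ := by
    rw [modIndicator, integrable_indicator_iff hBm]
    exact (S.continuous_chi_mul l).continuousOn.integrableOn_compact (isCompact_closedBall _ _)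
  have key := VectorFourier.integral_fourierIntegral_smul_eq_flip (μ := μ) (ν := μ)
    (L := LinearMap.mul K K) S.χ_cont continuous_mul hf hg
  have hr : ∀ x, VectorFourier.fourierIntegral S.χ μ (LinearMap.mul K K).flip
      (S.modIndicator B l) x =
      (closedBall l 1).indicator (fun x => (S.χ (x * -S.u s) : ℂ)) x := by
    intro x
    have e : VectorFourier.fourierIntegral S.χ μ (LinearMap.mul K K).flip
        (S.modIndicator B l) x = ∫ ξ in B, (S.χ (ξ * (l - x)) : ℂ) ∂μ := by
      rw [VectorFourier.fourierIntegral, ← integral_indicator hBm]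
      congr 1
      ext ξ
      by_cases hξ : ξ ∈ B
      · rw [modIndicator, Set.indicator_of_mem hξ, Set.indicator_of_mem hξ, Circle.smul_def,
          smul_eq_mul, ← S.chi_add]
        congr 2
        simp only [LinearMap.flip_apply, LinearMap.mul_apply']
        ring
      · rw [modIndicator, Set.indicator_of_notMem hξ, Set.indicator_of_notMem hξ, smul_zero]
    have h0 := S.setIntegral_closedBall_chi hμ 0 (S.u s) (l - x)
    rw [zpow_zero, neg_zero, zpow_zero, ← hB] at h0
    rw [e, h0, Set.indicator_apply, mem_closedBall, dist_comm, dist_eq_norm]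
    refine if_congr Iff.rfl ?_ rfl
    have e2 : S.u s * (l - x) = S.u s * l + x * -S.u s := by ring
    rw [e2, S.chi_add, S.chi_mul_of_mem_lattice (S.u_mem_lattice s) hl]
    simp
  rw [← integral_indicator hBm, ← integral_indicator measurableSet_closedBall]
  simp only [hr, smul_eq_mul] at key
  refine (integral_congr_ae (Eventually.of_forall fun ξ => ?_)).trans
    (key.trans (integral_congr_ae (Eventually.of_forall fun x => ?_)))
  · by_cases hξ : ξ ∈ B
    · simp only [modIndicator, Set.indicator_of_mem hξ, mul_comm]
      rfl
    · simp only [modIndicator, Set.indicator_of_notMem hξ, mul_zero]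
  · by_cases hx : x ∈ closedBall l 1
    · simp only [Set.indicator_of_mem hx, mul_comm]
    · simp only [Set.indicator_of_notMem hx, mul_zero]

/-- Both sides are locally integrable with the same lattice coefficients on every cell `u(s) + 𝔇`,
which determines them a.e. -/
theorem fourierIntegral_ae_eq_fourierL2 (f : Lp ℂ 2 μ) (hf : Integrable f μ) :
    Fourier.fourierIntegral S.χ μ f =ᵐ[μ] S.fourierL2 hμ f := by
  have hc := S.continuous_fourierIntegral hf
  have h1 : ∀ s, IntegrableOn (Fourier.fourierIntegral S.χ μ f) (closedBall (S.u s) 1) μ :=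
    fun s => hc.continuousOn.integrableOn_compact (isCompact_closedBall _ _)
  have h2 : ∀ s, IntegrableOn (S.fourierL2 hμ f) (closedBall (S.u s) 1) μ :=
    fun s => integrableOn_of_lp (measure_closedBall_ne_top _) _
  have key := S.ae_eq_zero_of_forall_setIntegral_closedBall_u hμ
    (f := fun ξ => Fourier.fourierIntegral S.χ μ f ξ - S.fourierL2 hμ f ξ)
    (fun s => (h1 s).sub (h2 s)) fun s l hl => by
      simp only [mul_sub]
      rw [integral_sub ((S.integrable_chi_mul_iff l).2 (h1 s))
        ((S.integrable_chi_mul_iff l).2 (h2 s)), S.setIntegral_chi_mul_fourierIntegral hμ hf s hl,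
        sub_eq_zero, ← S.inner_gabor, ← S.inner_gabor_fourierL2 hμ s hl, S.inner_gabor, neg_neg]
  filter_upwards [key] with ξ hξ
  exact sub_eq_zero.1 hξ

omit [IsUltrametricDist K] [BorelSpace K] [μ.IsAddHaarMeasure] [ProperSpace K] hμ in
theorem tendsto_eLpNorm_indicator_closedBall_sub [OpensMeasurableSpace K] {f : K → ℂ}
    (hf : MemLp f 2 μ) :
    Tendsto (fun n : ℕ => eLpNorm ((closedBall (0 : K) (n : ℝ)).indicator f - f) 2 μ)
      atTop (𝓝 0) := by
  have hfin := (eLpNorm_lt_top_iff_lintegral_rpow_enorm_lt_top two_ne_zero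
    ENNReal.ofNat_ne_top).1 hf.2
  simp only [eLpNorm_eq_lintegral_rpow_enorm_toReal two_ne_zero ENNReal.ofNat_ne_top]
  have h0 : (0 : ℝ≥0∞) = (∫⁻ _, 0 ∂μ) ^ (1 / (2 : ℝ≥0∞).toReal) := by simp
  rw [h0]
  refine (ENNReal.continuous_rpow_const.tendsto _).comp ?_
  refine tendsto_lintegral_of_dominated_convergence' (fun x => ‖f x‖ₑ ^ (2 : ℝ≥0∞).toReal)
    (fun n => ?_) (fun n => Eventually.of_forall fun x => ?_) hfin.ne
    (Eventually.of_forall fun x => ?_)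
  · exact ((hf.1.indicator measurableSet_closedBall).sub hf.1).enorm.pow_const _
  · by_cases hx : x ∈ closedBall (0 : K) (n : ℝ) <;> simp [hx]
  · obtain ⟨N, hN⟩ := exists_nat_ge ‖x‖
    refine tendsto_const_nhds.congr' ?_
    filter_upwards [eventually_ge_atTop N] with n hn
    have hx : x ∈ closedBall (0 : K) (n : ℝ) := by
      rw [mem_closedBall, dist_zero_right]
      exact hN.trans (by exact_mod_cast hn)
    simp [hx]

end FourierL2

/-! ### Approximation in `L²` by integrable truncations. -/

section Truncation

variable {K : Type*} [NontriviallyNormedField K] [MeasurableSpace K] [BorelSpace K] {μ : Measure K}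

/-- The truncation of a function in `L²` to the ball of radius `n`. -/
noncomputable def truncation (f : Lp ℂ 2 μ) (n : ℕ) : Lp ℂ 2 μ :=
  ((Lp.memLp f).indicator (measurableSet_closedBall (x := (0 : K)) (ε := n))).toLp _

theorem coeFn_truncation (f : Lp ℂ 2 μ) (n : ℕ) :
    truncation f n =ᵐ[μ] (closedBall (0 : K) (n : ℝ)).indicator f :=
  MemLp.coeFn_toLp _

theorem tendsto_truncation (f : Lp ℂ 2 μ) : Tendsto (truncation f) atTop (𝓝 f) := by
  rw [Lp.tendsto_Lp_iff_tendsto_eLpNorm']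
  refine (tendsto_eLpNorm_indicator_closedBall_sub (Lp.memLp f)).congr fun n => ?_
  refine eLpNorm_congr_ae ?_
  filter_upwards [coeFn_truncation f n] with x hx
  simp [hx]

theorem integrable_truncation [ProperSpace K] [IsFiniteMeasureOnCompacts μ] (f : Lp ℂ 2 μ)
    (n : ℕ) : Integrable (truncation f n) μ := by
  rw [integrable_congr (coeFn_truncation f n), integrable_indicator_iff measurableSet_closedBall]
  exact integrableOn_of_lp (isCompact_closedBall _ _).measure_lt_top.ne f

end Truncation

/-! ### The Fourier transform of dilations and translations. -/

section Intertwining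

variable {K : Type*} [NontriviallyNormedField K] [IsUltrametricDist K] {p c : ℕ}
  (S : AffineSetting K p c) [MeasurableSpace K] [BorelSpace K]
  {μ : Measure K} [μ.IsAddHaarMeasure] [Fact p.Prime] [CharP K p]
  [ProperSpace K] (hμ : μ (closedBall (0 : K) 1) = 1)

/-- A measurable Fourier transform in the sense of `L²` limits is given by `fourierL2`. -/
theorem IsFourierTransform.ae_eq_fourierL2 {f : Lp ℂ 2 μ} {g : K → ℂ}
    (hg : AEStronglyMeasurable g μ) (h : S.IsFourierTransform μ f g) :
    g =ᵐ[μ] S.fourierL2 hμ f := by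
  set U := S.fourierL2 hμ
  let F : ℕ → K → ℂ := fun n => U (truncation f n)
  let V : K → ℂ := U f
  have h1 : Tendsto (fun n : ℕ => eLpNorm (F n - g) 2 μ) atTop (𝓝 0) := by
    refine h.congr fun n => eLpNorm_congr_ae ?_
    filter_upwards [S.fourierIntegral_ae_eq_fourierL2 hμ _ (integrable_truncation f n)] with ξ hξ
    rw [Pi.sub_apply, show F n ξ = _ from hξ.symm]
    congr 1
    exact congrFun (VectorFourier.fourierIntegral_congr_ae S.χ μ (LinearMap.mul K K)
      (coeFn_truncation f n).symm) ξ
  have h2 : Tendsto (fun n : ℕ => eLpNorm (F n - V) 2 μ) atTop (𝓝 0) :=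
    (Lp.tendsto_Lp_iff_tendsto_eLpNorm' _ _).1
      ((U.continuous.tendsto f).comp (tendsto_truncation f))
  have h3 : ∀ n : ℕ, eLpNorm (g - V) 2 μ ≤
      eLpNorm (F n - g) 2 μ + eLpNorm (F n - V) 2 μ := by
    intro n
    have e : g - V = (g - F n) + (F n - V) := by
      rw [sub_add_sub_cancel]
    have hU := fun f : Lp ℂ 2 μ => Lp.aestronglyMeasurable (U f)
    rw [e, eLpNorm_sub_comm (F n) g]
    exact eLpNorm_add_le (hg.sub (hU _)) ((hU _).sub (hU _)) one_le_two
  have h4 : eLpNorm (g - V) 2 μ = 0 := by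
    have h5 := h1.add h2
    rw [add_zero] at h5
    exact le_antisymm (ge_of_tendsto' h5 h3) zero_le
  rw [eLpNorm_eq_zero_iff (hg.sub (Lp.aestronglyMeasurable _)) two_ne_zero] at h4
  filter_upwards [h4] with ξ hξ
  exact sub_eq_zero.1 hξ

include hμ

theorem quasiMeasurePreserving_zpow_mul_sub (j : ℤ) (b : K) :
    Measure.QuasiMeasurePreserving (fun x => S.unif ^ j * x - b) μ μ :=
  (measurePreserving_sub_right μ b).quasiMeasurePreserving.comp
    (S.quasiMeasurePreserving_dilation hμ j)

theorem lintegral_zpow_mul_sub (j : ℤ) (b : K) (f : K → ℝ≥0∞) :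
    ∫⁻ x, f (S.unif ^ j * x - b) ∂μ = ENNReal.ofReal ((S.q : ℝ) ^ j) * ∫⁻ x, f x ∂μ := by
  rw [S.lintegral_zpow_mul hμ j fun x => f (x - b), lintegral_sub_right_eq_self]

theorem eLpNorm_mul_zpow_mul_sub (j : ℤ) (b : K) {m : K → ℂ}
    (hm : ∀ x, ‖m x‖ = (S.q : ℝ) ^ (-(j : ℝ) / 2)) (f : K → ℂ) :
    eLpNorm (fun x => m x * f (S.unif ^ j * x - b)) 2 μ = eLpNorm f 2 μ := by
  have hq := S.q_pos
  rw [eLpNorm_eq_lintegral_rpow_enorm_toReal two_ne_zero ENNReal.ofNat_ne_top,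
    eLpNorm_eq_lintegral_rpow_enorm_toReal two_ne_zero ENNReal.ofNat_ne_top]
  congr 1
  have h1 : ∀ x, ‖m x * f (S.unif ^ j * x - b)‖ₑ ^ (2 : ℝ≥0∞).toReal =
      ENNReal.ofReal ((S.q : ℝ) ^ (-j)) * ‖f (S.unif ^ j * x - b)‖ₑ ^ (2 : ℝ≥0∞).toReal := by
    intro x
    rw [enorm_mul, ENNReal.mul_rpow_of_nonneg _ _ (by positivity)]
    congr 1
    rw [← ofReal_norm, hm, ENNReal.ofReal_rpow_of_pos (by positivity), ← Real.rpow_mul hq.le,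
      ← Real.rpow_intCast]
    congr 2
    simp
  simp only [h1]
  rw [lintegral_const_mul' _ _ ENNReal.ofReal_ne_top,
    S.lintegral_zpow_mul_sub hμ j b fun x => ‖f x‖ₑ ^ (2 : ℝ≥0∞).toReal, ← mul_assoc,
    ← ENNReal.ofReal_mul (by positivity), ← zpow_add₀ hq.ne']
  simp

theorem memLp_mul_zpow_mul_sub (j : ℤ) (b : K) {m : K → ℂ} (hmm : Measurable m)
    (hm : ∀ x, ‖m x‖ = (S.q : ℝ) ^ (-(j : ℝ) / 2)) (f : Lp ℂ 2 μ) :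
    MemLp (fun x => m x * f (S.unif ^ j * x - b)) 2 μ := by
  refine ⟨?_, ?_⟩
  · exact hmm.aestronglyMeasurable.mul ((Lp.aestronglyMeasurable f).comp_quasiMeasurePreserving
      (S.quasiMeasurePreserving_zpow_mul_sub hμ j b))
  · rw [S.eLpNorm_mul_zpow_mul_sub hμ j b hm]
    exact (Lp.memLp f).2

/-- The isometry `f ↦ m · f(𝔭ʲ · - b)` of `L²(K)`, where `|m| = q^{-j/2}`. -/
theorem exists_isometry_mul_zpow_mul_sub (j : ℤ) (b : K) {m : K → ℂ} (hmm : Measurable m)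
    (hm : ∀ x, ‖m x‖ = (S.q : ℝ) ^ (-(j : ℝ) / 2)) :
    ∃ T : Lp ℂ 2 μ →ₗᵢ[ℂ] Lp ℂ 2 μ, ∀ f, T f =ᵐ[μ] fun x => m x * f (S.unif ^ j * x - b) := by
  have hqm := S.quasiMeasurePreserving_zpow_mul_sub hμ j b
  have hM := S.memLp_mul_zpow_mul_sub hμ j b hmm hm
  let T : Lp ℂ 2 μ →ₗ[ℂ] Lp ℂ 2 μ :=
    { toFun := fun f => (hM f).toLp _
      map_add' := fun f g => by
        refine Lp.ext ?_
        filter_upwards [(hM (f + g)).coeFn_toLp, (hM f).coeFn_toLp, (hM g).coeFn_toLp,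
          Lp.coeFn_add ((hM f).toLp _) ((hM g).toLp _), hqm.ae (Lp.coeFn_add f g)]
          with x h1 h2 h3 h4 h5
        rw [h1, h4, Pi.add_apply, h2, h3, h5, Pi.add_apply, mul_add]
      map_smul' := fun a f => by
        refine Lp.ext ?_
        filter_upwards [(hM (a • f)).coeFn_toLp, (hM f).coeFn_toLp,
          Lp.coeFn_smul a ((hM f).toLp _), hqm.ae (Lp.coeFn_smul a f)] with x h1 h2 h3 h4
        rw [h1, RingHom.id_apply, h3, Pi.smul_apply, h2, h4, Pi.smul_apply, smul_eq_mul,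
          smul_eq_mul, mul_left_comm] }
  refine ⟨⟨T, fun f => ?_⟩, fun f => (hM f).coeFn_toLp⟩
  change ‖(hM f).toLp _‖ = ‖f‖
  rw [Lp.norm_toLp, S.eLpNorm_mul_zpow_mul_sub hμ j b hm, Lp.norm_def]

theorem exists_affine_isometry (j : ℤ) (t : ℕ) :
    ∃ T : Lp ℂ 2 μ →ₗᵢ[ℂ] Lp ℂ 2 μ, ∀ f : Lp ℂ 2 μ, T f =ᵐ[μ] S.affine f j t := by
  have hq := S.q_pos
  refine S.exists_isometry_mul_zpow_mul_sub hμ (-j) (S.u t)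
    (m := fun _ => (((S.q : ℝ) ^ ((j : ℝ) / 2) : ℝ) : ℂ)) measurable_const fun x => ?_
  rw [Complex.norm_real, Real.norm_of_nonneg (by positivity)]
  congr 2
  push_cast
  ring

omit hμ [CharP K p] [ProperSpace K] [MeasurableSpace K] [BorelSpace K] in
theorem norm_rpow_mul_chi (j : ℤ) (x : K) :
    ‖(((S.q : ℝ) ^ (-(j : ℝ) / 2) : ℝ) : ℂ) * S.χ x‖ = (S.q : ℝ) ^ (-(j : ℝ) / 2) := by
  have hq := S.q_pos
  rw [norm_mul, Circle.norm_coe, mul_one, Complex.norm_real, Real.norm_of_nonneg (by positivity)]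

theorem exists_modulation_isometry (j : ℤ) (t : ℕ) :
    ∃ T : Lp ℂ 2 μ →ₗᵢ[ℂ] Lp ℂ 2 μ, ∀ f : Lp ℂ 2 μ, T f =ᵐ[μ] fun ξ =>
      (((S.q : ℝ) ^ (-(j : ℝ) / 2) : ℝ) : ℂ) * S.χ (ξ * (S.unif ^ j * -S.u t)) *
        f (S.unif ^ j * ξ) := by
  obtain ⟨T, hT⟩ := S.exists_isometry_mul_zpow_mul_sub hμ j 0
    (m := fun ξ => (((S.q : ℝ) ^ (-(j : ℝ) / 2) : ℝ) : ℂ) * S.χ (ξ * (S.unif ^ j * -S.u t)))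
    ((S.continuous_chi_mul _).measurable.const_mul _) fun x => S.norm_rpow_mul_chi j _
  exact ⟨T, fun f => by simpa only [sub_zero] using hT f⟩

theorem fourierIntegral_affine (f : K → ℂ) (j : ℤ) (t : ℕ) (ξ : K) :
    Fourier.fourierIntegral S.χ μ (S.affine f j t) ξ =
      (((S.q : ℝ) ^ (-(j : ℝ) / 2) : ℝ) : ℂ) * S.χ (ξ * (S.unif ^ j * -S.u t)) *
        Fourier.fourierIntegral S.χ μ f (S.unif ^ j * ξ) := by
  have hq := S.q_pos
  have hu := S.unif_ne_zero
  simp only [Fourier.fourierIntegral_def, Circle.smul_def, smul_eq_mul, affine]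
  set G : K → ℂ := fun y => (S.χ (-((S.unif ^ j * y) * ξ)) : ℂ) *
    ((((S.q : ℝ) ^ ((j : ℝ) / 2) : ℝ) : ℂ) * f (y - S.u t)) with hG
  have h1 : ∀ x, (S.χ (-(x * ξ)) : ℂ) * ((((S.q : ℝ) ^ ((j : ℝ) / 2) : ℝ) : ℂ) *
      f (S.unif ^ (-j) * x - S.u t)) = G (S.unif ^ (-j) * x) := by
    intro x
    rw [hG]
    congr 4
    have := S.zpow_neg_mul_cancel (-j) x
    rw [neg_neg] at this
    rw [this]
  simp only [h1]
  rw [S.integral_zpow_mul hμ, ← integral_add_right_eq_self G (S.u t)]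
  have h2 : ∀ y, G (y + S.u t) = ((((S.q : ℝ) ^ ((j : ℝ) / 2) : ℝ) : ℂ) *
      S.χ (ξ * (S.unif ^ j * -S.u t))) * ((S.χ (-(y * (S.unif ^ j * ξ))) : ℂ) * f y) := by
    intro y
    have e : -(S.unif ^ j * (y + S.u t) * ξ) =
        ξ * (S.unif ^ j * -S.u t) + -(y * (S.unif ^ j * ξ)) := by ring
    simp only [hG, add_sub_cancel_right, e, S.chi_add]
    ring
  simp only [h2]
  rw [integral_const_mul, ← mul_assoc, ← mul_assoc, ← Complex.ofReal_mul]
  congr 4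
  rw [← Real.rpow_intCast, ← Real.rpow_add hq]
  congr 1
  push_cast
  ring

theorem integrable_affine {f : K → ℂ} (hf : Integrable f μ) (j : ℤ) (t : ℕ) :
    Integrable (S.affine f j t) μ := by
  refine Integrable.const_mul ?_ _
  have h : Integrable (fun x => f (x - S.u t)) (μ.map (S.dilation (-j))) := by
    rw [S.map_dilation hμ]
    exact (hf.comp_sub_right (S.u t)).smul_measure ENNReal.ofReal_ne_top
  exact (integrable_map_equiv (S.dilation (-j)) _).1 h

/-- The Fourier transform of the affine system. -/
theorem fourierL2_affine {A : Lp ℂ 2 μ →ₗᵢ[ℂ] Lp ℂ 2 μ} {j : ℤ} {t : ℕ}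
    (hA : ∀ f : Lp ℂ 2 μ, A f =ᵐ[μ] S.affine f j t) (f : Lp ℂ 2 μ) :
    S.fourierL2 hμ (A f) =ᵐ[μ] fun ξ =>
      (((S.q : ℝ) ^ (-(j : ℝ) / 2) : ℝ) : ℂ) * S.χ (ξ * (S.unif ^ j * -S.u t)) *
        S.fourierL2 hμ f (S.unif ^ j * ξ) := by
  obtain ⟨G, hG⟩ := S.exists_modulation_isometry hμ j t
  suffices h : S.fourierL2 hμ (A f) = G (S.fourierL2 hμ f) by
    rw [h]
    exact hG _
  -- For integrable functions this is a change of variables in the integral; continuity and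
  -- truncation extend it to `L²`.
  have hint : ∀ g : Lp ℂ 2 μ, Integrable g μ →
      S.fourierL2 hμ (A g) = G (S.fourierL2 hμ g) := by
    intro g hg
    have hAg : Integrable (A g) μ := (integrable_congr (hA g)).2 (S.integrable_affine hμ hg j t)
    refine Lp.ext ?_
    filter_upwards [S.fourierIntegral_ae_eq_fourierL2 hμ _ hAg, hG (S.fourierL2 hμ g),
      (S.quasiMeasurePreserving_dilation hμ j).ae (S.fourierIntegral_ae_eq_fourierL2 hμ g hg)]
      with ξ h1 h2 h3
    rw [← h1, h2]
    rw [dilation_apply] at h3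
    rw [← h3, ← S.fourierIntegral_affine hμ]
    exact congrFun (VectorFourier.fourierIntegral_congr_ae S.χ μ (LinearMap.mul K K) (hA g)) ξ
  have h1 : Tendsto (fun n => S.fourierL2 hμ (A (truncation f n))) atTop
      (𝓝 (S.fourierL2 hμ (A f))) :=
    (((S.fourierL2 hμ).continuous.comp A.continuous).tendsto f).comp (tendsto_truncation f)
  have h2 : Tendsto (fun n => G (S.fourierL2 hμ (truncation f n))) atTop
      (𝓝 (G (S.fourierL2 hμ f))) :=
    ((G.continuous.comp (S.fourierL2 hμ).continuous).tendsto f).comp (tendsto_truncation f)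
  refine tendsto_nhds_unique h1 (h2.congr fun n => ?_)
  exact (hint _ (integrable_truncation f n)).symm

end Intertwining

/-! ### Disjointness and covering by dilates, and the integral of `1/|ξ|`. -/

section Partition

variable {K : Type*} [NontriviallyNormedField K] [IsUltrametricDist K] {p c : ℕ}
  (S : AffineSetting K p c) [Fact p.Prime] [MeasurableSpace K] [BorelSpace K] {L : ℕ}

theorem measurableSet_zpow_smul {E : Set K} (hE : MeasurableSet E) (j : ℤ) :
    MeasurableSet (S.unif ^ j • E) := by
  rw [S.zpow_smul_eq_preimage]
  exact (S.dilation (-j)).measurable hE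

omit [MeasurableSpace K] [BorelSpace K] in
theorem zpow_smul_zpow_smul (i j : ℤ) (E : Set K) :
    S.unif ^ i • S.unif ^ j • E = S.unif ^ (i + j) • E := by
  rw [smul_smul, ← zpow_add₀ S.unif_ne_zero]

omit [MeasurableSpace K] [BorelSpace K] in
theorem zpow_smul_inter (j : ℤ) (E F : Set K) :
    S.unif ^ j • (E ∩ F) = S.unif ^ j • E ∩ S.unif ^ j • F := by
  ext x
  simp only [Set.mem_inter_iff, S.mem_zpow_smul_iff]

variable {μ : Measure K} [μ.IsAddHaarMeasure] [CharP K p] [ProperSpace K]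
  (hμ : μ (closedBall (0 : K) 1) = 1) {W : Fin L → Set K} (hW : ∀ m, MeasurableSet (W m))

include hμ

omit [ProperSpace K] in
theorem measure_inter_pow_smul (hW : ∀ m, MeasurableSet (W m)) (h : S.SetOrthogonality μ W)
    (l m : Fin L) (j : ℕ) :
    μ (W l ∩ S.unif ^ j • W m) = (if j = 0 ∧ l = m then 1 else 0 : ℕ) := by
  have hm : MeasurableSet (S.unif ^ j • W m) := by
    rw [← zpow_natCast]
    exact S.measurableSet_zpow_smul (hW m) j
  refine S.measure_of_ae_tsum_indicator_eq hμ ((hW l).inter hm) ?_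
  filter_upwards [h l m j] with ξ hξ
  rw [hξ]
  split_ifs <;> simp

/-- Scaling out the smaller exponent leaves an intersection `W_l ∩ 𝔭^i W_m` with `i ≥ 0`, which is
null by (a). -/
theorem measure_zpow_smul_inter (hW : ∀ m, MeasurableSet (W m)) (h : S.SetOrthogonality μ W)
    {a b : ℤ × Fin L} (hab : a ≠ b) :
    μ (S.unif ^ a.1 • W a.2 ∩ S.unif ^ b.1 • W b.2) = 0 := by
  wlog hle : a.1 ≤ b.1 generalizing a b
  · rw [Set.inter_comm]
    exact this hab.symm (not_le.1 hle).le
  obtain ⟨i, hi⟩ := Int.eq_ofNat_of_zero_le (sub_nonneg.2 hle)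
  have e : S.unif ^ b.1 • W b.2 = S.unif ^ a.1 • S.unif ^ i • W b.2 := by
    rw [← zpow_natCast, S.zpow_smul_zpow_smul, ← hi]
    congr 2
    ring
  rw [e, ← S.zpow_smul_inter, S.measure_zpow_smul hμ, S.measure_inter_pow_smul hμ hW h, if_neg]
  · simp
  · rintro ⟨h0, h1⟩
    refine hab (Prod.ext ?_ h1)
    subst h0
    push_cast at hi
    linarith

omit [ProperSpace K] in
theorem measure_sphere : μ (sphere (0 : K) 1) = ((S.q : ℝ≥0∞) - 1) / (S.q : ℝ≥0∞) := by
  have hq := S.one_lt_q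
  have hun : closedBall (0 : K) 1 = sphere 0 1 ∪ closedBall 0 (S.q : ℝ)⁻¹ := by
    ext x
    simp only [mem_closedBall, mem_sphere, dist_zero_right, Set.mem_union]
    constructor
    · intro h
      rcases h.lt_or_eq with h | h
      · right
        have := S.norm_le_unif x h
        rwa [S.norm_unif_eq] at this
      · exact Or.inl h
    · rintro (h | h)
      · exact h.le
      · exact h.trans (inv_le_one_of_one_le₀ S.one_lt_q_real.le)
  have hdis : Disjoint (sphere (0 : K) 1) (closedBall 0 (S.q : ℝ)⁻¹) := by
    rw [Set.disjoint_left]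
    intro x hx hx'
    rw [mem_sphere] at hx
    rw [mem_closedBall, hx] at hx'
    exact (inv_lt_one_of_one_lt₀ S.one_lt_q_real).not_ge hx'
  have h1 := measure_union (μ := μ) hdis measurableSet_closedBall
  rw [← hun, hμ, S.measure_closedBall_inv hμ] at h1
  have hq0 : (S.q : ℝ≥0∞) ≠ 0 := by exact_mod_cast (zero_lt_one.trans hq).ne'
  have h2 : ((S.q : ℝ≥0∞) - 1) / (S.q : ℝ≥0∞) + (S.q : ℝ≥0∞)⁻¹ = 1 := by
    rw [← one_div, ENNReal.div_add_div_same, tsub_add_cancel_of_le (by exact_mod_cast hq.le)]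
    exact ENNReal.div_self hq0 (ENNReal.natCast_ne_top _)
  exact ((ENNReal.add_left_inj (ENNReal.inv_ne_top.2 hq0)).1 (h2.trans h1)).symm

omit [IsUltrametricDist K] [Fact p.Prime] [CharP K p] hμ in
theorem ae_ne_zero : ∀ᵐ x ∂μ, x ≠ (0 : K) := by
  simp [ae_iff]

omit [MeasurableSpace K] [BorelSpace K] [CharP K p] [ProperSpace K] hμ in
theorem exists_mem_zpow_smul_sphere {x : K} (hx : x ≠ 0) :
    ∃ j : ℤ, x ∈ S.unif ^ j • sphere (0 : K) 1 := by
  obtain ⟨n, hn⟩ := S.norm_eq_zpow_of_ne_zero hx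
  refine ⟨-n, ?_⟩
  rw [S.mem_zpow_smul_iff, mem_sphere, dist_zero_right, norm_mul, S.norm_unif_zpow, hn,
    ← zpow_add₀ S.q_pos.ne']
  simp

omit [MeasurableSpace K] [BorelSpace K] [CharP K p] [ProperSpace K] hμ in
theorem mem_zpow_smul_sphere_iff {x : K} {j : ℤ} :
    x ∈ S.unif ^ j • sphere (0 : K) 1 ↔ ‖x‖ = (S.q : ℝ) ^ (-j) := by
  have hq := S.q_pos
  rw [S.mem_zpow_smul_iff, mem_sphere, dist_zero_right, norm_mul, S.norm_unif_zpow, neg_neg,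
    zpow_neg, mul_comm, mul_eq_one_iff_eq_inv₀ (by positivity)]

/-- On each shell `|ξ| = q^j` the weight is the constant `q^{-j}`, exactly the factor by which `𝔭^j`
scales measure when moving that shell to the unit sphere. -/
theorem setLIntegral_enorm_inv {E : Set K} (hE : MeasurableSet E) :
    ∫⁻ ξ in E, ‖ξ‖ₑ⁻¹ ∂μ = ∑' j : ℤ, μ (S.unif ^ j • E ∩ sphere (0 : K) 1) := by
  have hq := S.q_pos
  have hSm : ∀ j : ℤ, MeasurableSet (S.unif ^ j • sphere (0 : K) 1) :=
    S.measurableSet_zpow_smul isClosed_sphere.measurableSet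
  have h1 : E =ᵐ[μ] ⋃ j : ℤ, E ∩ S.unif ^ j • sphere (0 : K) 1 := by
    filter_upwards [ae_ne_zero (μ := μ)] with x hx
    obtain ⟨j, hj⟩ := S.exists_mem_zpow_smul_sphere hx
    refine propext ⟨fun h => Set.mem_iUnion.2 ⟨j, h, hj⟩, fun h => ?_⟩
    obtain ⟨_, h, _⟩ := Set.mem_iUnion.1 h
    exact h
  have hdis : Pairwise (Function.onFun Disjoint
      fun j : ℤ => E ∩ S.unif ^ j • sphere (0 : K) 1) := by
    intro i j hij
    rw [Function.onFun, Set.disjoint_left]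
    rintro x ⟨_, hx⟩ ⟨_, hx'⟩
    rw [S.mem_zpow_smul_sphere_iff] at hx hx'
    rw [hx] at hx'
    exact hij (neg_injective (zpow_right_injective₀ hq S.one_lt_q_real.ne' hx'))
  rw [setLIntegral_congr h1, lintegral_iUnion (fun j => hE.inter (hSm j)) hdis,
    ← (Equiv.neg ℤ).tsum_eq]
  refine tsum_congr fun j => ?_
  have h2 : ∀ x ∈ E ∩ S.unif ^ (-j) • sphere (0 : K) 1,
      ‖x‖ₑ⁻¹ = ENNReal.ofReal ((S.q : ℝ) ^ (-j)) := by
    rintro x ⟨_, hx⟩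
    rw [S.mem_zpow_smul_sphere_iff, neg_neg] at hx
    rw [← ofReal_norm, hx, ← ENNReal.ofReal_inv_of_pos (by positivity), zpow_neg]
  rw [Equiv.neg_apply, setLIntegral_congr_fun (hE.inter (hSm _)) h2, setLIntegral_const,
    ← S.measure_zpow_smul hμ, S.zpow_smul_inter, S.zpow_smul_zpow_smul]
  simp

/-- All the dilates are a.e. disjoint by (a), so the shell contributions add up to the measure of
one union. -/
theorem setLIntegral_iUnion_enorm_inv (hW : ∀ m, MeasurableSet (W m))
    (h : S.SetOrthogonality μ W) :
    ∫⁻ ξ in ⋃ m, W m, ‖ξ‖ₑ⁻¹ ∂μ =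
      μ ((⋃ a : ℤ × Fin L, S.unif ^ a.1 • W a.2) ∩ sphere (0 : K) 1) := by
  have h1 : Pairwise (Function.onFun (AEDisjoint μ) W) := by
    intro l m hlm
    have := S.measure_zpow_smul_inter hμ hW h (a := (0, l)) (b := (0, m)) (by simpa using hlm)
    simp only [zpow_zero, one_smul] at this
    exact this
  have hm : ∀ a : ℤ × Fin L, MeasurableSet (S.unif ^ a.1 • W a.2 ∩ sphere (0 : K) 1) :=
    fun a => (S.measurableSet_zpow_smul (hW _) _).inter isClosed_sphere.measurableSet
  rw [lintegral_iUnion₀ (fun m => (hW m).nullMeasurableSet) h1, Set.iUnion_inter,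
    measure_iUnion₀ _ fun a => (hm a).nullMeasurableSet]
  · simp only [S.setLIntegral_enorm_inv hμ (hW _)]
    rw [ENNReal.tsum_comm, ← ENNReal.tsum_prod (f := fun (j : ℤ) (m : Fin L) =>
      μ (S.unif ^ j • W m ∩ sphere (0 : K) 1))]
  · intro a b hab
    refine measure_mono_null ?_ (S.measure_zpow_smul_inter hμ hW h hab)
    exact Set.inter_subset_inter Set.inter_subset_left Set.inter_subset_left

theorem dilatesPartition_iff_cover (hW : ∀ m, MeasurableSet (W m)) (h : S.SetOrthogonality μ W) :
    S.DilatesPartition μ W ↔ ∀ᵐ ξ ∂μ, ∃ (j : ℤ) (m : Fin L), ξ ∈ S.unif ^ j • W m :=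
  ⟨fun h' => h'.2.2, fun h' => ⟨fun j m => S.measurableSet_zpow_smul (hW m) j,
    fun _ _ hab => S.measure_zpow_smul_inter hμ hW h hab, h'⟩⟩

/-- The integral condition says that the union of dilates fills the unit sphere, whose measure is
finite. The union is invariant under powers of 𝔭 and the dilated spheres exhaust the nonzero
elements, so it then fills K. -/
theorem cover_iff_lintegral (hW : ∀ m, MeasurableSet (W m)) (h : S.SetOrthogonality μ W) :
    (∀ᵐ ξ ∂μ, ∃ (j : ℤ) (m : Fin L), ξ ∈ S.unif ^ j • W m) ↔
      ∫⁻ ξ in ⋃ m, W m, ‖ξ‖ₑ⁻¹ ∂μ = ((S.q : ℝ≥0∞) - 1) / (S.q : ℝ≥0∞) := by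
  rw [S.setLIntegral_iUnion_enorm_inv hμ hW h, ← S.measure_sphere hμ]
  set V : Set K := ⋃ a : ℤ × Fin L, S.unif ^ a.1 • W a.2 with hV
  have hmem : ∀ ξ, ξ ∈ V ↔ ∃ (j : ℤ) (m : Fin L), ξ ∈ S.unif ^ j • W m := fun ξ => by
    rw [hV, Set.mem_iUnion]
    exact ⟨fun ⟨a, ha⟩ => ⟨a.1, a.2, ha⟩, fun ⟨j, m, hjm⟩ => ⟨(j, m), hjm⟩⟩
  have hVm : MeasurableSet V := MeasurableSet.iUnion fun a => S.measurableSet_zpow_smul (hW _) _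
  simp only [← hmem]
  constructor
  · intro hc
    refine measure_congr ?_
    filter_upwards [hc] with x hx
    exact propext ⟨fun h => h.2, fun h => ⟨hx, h⟩⟩
  · intro heq
    have hfin : μ (sphere (0 : K) 1) ≠ ∞ := (isCompact_sphere _ _).measure_lt_top.ne
    have h0 : μ (sphere (0 : K) 1 \ V) = 0 := by
      have h1 := measure_inter_add_sdiff (μ := μ) (sphere (0 : K) 1) hVm
      rw [Set.inter_comm, heq] at h1
      have h2 : μ (sphere (0 : K) 1) + μ (sphere (0 : K) 1 \ V) = μ (sphere (0 : K) 1) + 0 := by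
        rw [h1, add_zero]
      exact (ENNReal.add_right_inj hfin).1 h2
    have hinv : ∀ (j : ℤ) (ξ : K), ξ ∈ V → S.unif ^ j * ξ ∈ V := by
      intro j ξ hξ
      rw [hmem] at hξ ⊢
      obtain ⟨k, m, hk⟩ := hξ
      refine ⟨j + k, m, ?_⟩
      rw [← S.zpow_smul_zpow_smul]
      exact Set.smul_mem_smul_set hk
    have h3 : ∀ j : ℤ, μ (S.unif ^ j • (sphere (0 : K) 1 \ V)) = 0 := fun j => by
      rw [S.measure_zpow_smul hμ, h0, mul_zero]
    have h4 := measure_iUnion_null h3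
    filter_upwards [ae_ne_zero (μ := μ), measure_eq_zero_iff_ae_notMem.1 h4] with x hx hx'
    by_contra hxV
    apply hx'
    obtain ⟨j, hj⟩ := S.exists_mem_zpow_smul_sphere hx
    refine Set.mem_iUnion.2 ⟨j, ?_⟩
    rw [S.mem_zpow_smul_iff] at hj ⊢
    refine ⟨hj, fun hV' => hxV ?_⟩
    have := hinv j _ hV'
    have e := S.zpow_neg_mul_cancel (-j) x
    rw [neg_neg] at e
    rwa [e] at this

end Partition

/-! ### The affine system on the Fourier side: orthonormality and completeness. -/

section Spectral

variable {K : Type*} [NontriviallyNormedField K] [IsUltrametricDist K] {p c : ℕ}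
  (S : AffineSetting K p c) [Fact p.Prime] [MeasurableSpace K] [BorelSpace K] {L : ℕ}
  {μ : Measure K} [μ.IsAddHaarMeasure] [CharP K p] [ProperSpace K]
  (hμ : μ (closedBall (0 : K) 1) = 1) {W : Fin L → Set K}

include hμ

theorem setIntegral_zpow_smul (j : ℤ) {B : Set K} (hB : MeasurableSet B) (h : K → ℂ) :
    ∫ x in S.unif ^ j • B, h x ∂μ =
      (((S.q : ℝ) ^ (-j) : ℝ) : ℂ) * ∫ y in B, h (S.unif ^ j * y) ∂μ := by
  have hq := S.q_pos
  have h1 := S.integral_zpow_mul hμ j ((S.unif ^ j • B).indicator h)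
  have h2 : ∀ y, (S.unif ^ j • B).indicator h (S.unif ^ j * y) =
      B.indicator (fun y => h (S.unif ^ j * y)) y := by
    intro y
    have e : S.unif ^ j * y ∈ S.unif ^ j • B ↔ y ∈ B := by
      rw [S.mem_zpow_smul_iff, S.zpow_neg_mul_cancel]
    by_cases hy : y ∈ B
    · rw [Set.indicator_of_mem hy, Set.indicator_of_mem (e.2 hy)]
    · rw [Set.indicator_of_notMem hy, Set.indicator_of_notMem (mt e.1 hy)]
  simp only [h2] at h1
  rw [integral_indicator hB, integral_indicator (S.measurableSet_zpow_smul hB j)] at h1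
  rw [h1, ← mul_assoc, ← Complex.ofReal_mul, ← zpow_add₀ hq.ne']
  simp

theorem measure_zpow_smul_ne_top {E : Set K} (hE : μ E ≠ ∞) (j : ℤ) : μ (S.unif ^ j • E) ≠ ∞ := by
  rw [S.measure_zpow_smul hμ]
  exact ENNReal.mul_ne_top ENNReal.ofReal_ne_top hE

/-- The Fourier transform of the affine function with indices `j`, `t` generated by a function
whose Fourier transform is the indicator of `E`. -/
noncomputable def spectralVec {E : Set K} (hE : MeasurableSet E) (hfin : μ E ≠ ∞) (j : ℤ) (t : ℕ) :
    Lp ℂ 2 μ :=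
  (((S.q : ℝ) ^ (-(j : ℝ) / 2) : ℝ) : ℂ) •
    (S.memLp_modIndicator (S.measurableSet_zpow_smul hE (-j))
      (S.measure_zpow_smul_ne_top hμ hfin (-j)) (S.unif ^ j * -S.u t)).toLp _

omit hμ in
theorem coeFn_spectralVec (hμ : μ (closedBall (0 : K) 1) = 1) {E : Set K} (hE : MeasurableSet E)
    (hfin : μ E ≠ ∞) (j : ℤ) (t : ℕ) :
    S.spectralVec hμ hE hfin j t =ᵐ[μ] fun ξ => (((S.q : ℝ) ^ (-(j : ℝ) / 2) : ℝ) : ℂ) *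
      S.modIndicator (S.unif ^ (-j) • E) (S.unif ^ j * -S.u t) ξ := by
  filter_upwards [Lp.coeFn_smul (((S.q : ℝ) ^ (-(j : ℝ) / 2) : ℝ) : ℂ)
    ((S.memLp_modIndicator (S.measurableSet_zpow_smul hE (-j))
      (S.measure_zpow_smul_ne_top hμ hfin (-j)) (S.unif ^ j * -S.u t)).toLp _),
    (S.memLp_modIndicator (S.measurableSet_zpow_smul hE (-j))
      (S.measure_zpow_smul_ne_top hμ hfin (-j)) (S.unif ^ j * -S.u t)).coeFn_toLp] with ξ h1 h2
  rw [spectralVec, h1, Pi.smul_apply, h2, smul_eq_mul]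

omit hμ in
theorem inner_spectralVec (hμ : μ (closedBall (0 : K) 1) = 1) {E : Set K} (hE : MeasurableSet E)
    (hfin : μ E ≠ ∞) (j : ℤ) (t : ℕ) (g : Lp ℂ 2 μ) :
    inner ℂ (S.spectralVec hμ hE hfin j t) g = (((S.q : ℝ) ^ (-(j : ℝ) / 2) : ℝ) : ℂ) *
      ∫ x in S.unif ^ (-j) • E, (S.χ (x * (S.unif ^ j * S.u t)) : ℂ) * g x ∂μ := by
  rw [spectralVec, inner_smul_left, Complex.conj_ofReal,
    S.inner_toLp_modIndicator (S.measurableSet_zpow_smul hE (-j))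
      (S.measure_zpow_smul_ne_top hμ hfin (-j))]
  simp only [mul_neg, neg_neg]

omit hμ in
-- Substituting `x = 𝔭^{-(k+i)} y` removes the dependence on k. The resulting frequency lies in Λ
-- because `𝔭⁻¹Λ ⊆ Λ`, so the integral is a lattice coefficient.
theorem inner_spectralVec_spectralVec (hμ : μ (closedBall (0 : K) 1) = 1) {E F : Set K}
    (hE : MeasurableSet E) (hF : MeasurableSet F) (hEfin : μ E ≠ ∞) (hFfin : μ F ≠ ∞)
    (k : ℤ) (i t s : ℕ) :
    inner ℂ (S.spectralVec hμ hE hEfin (k + i) t) (S.spectralVec hμ hF hFfin k s) =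
      (((S.q : ℝ) ^ ((i : ℝ) / 2) : ℝ) : ℂ) *
        ∫ y in E ∩ S.unif ^ i • F, (S.χ (y * (S.u t - S.unif⁻¹ ^ i * S.u s)) : ℂ) ∂μ := by
  have hq := S.q_pos
  have hu := S.unif_ne_zero
  have hEm := S.measurableSet_zpow_smul hE (-(k + i))
  have hFm : MeasurableSet (S.unif ^ i • F) := by
    rw [← zpow_natCast]; exact S.measurableSet_zpow_smul hF i
  rw [S.inner_spectralVec]
  have h1 : ∫ x in S.unif ^ (-(k + i : ℤ)) • E, (S.χ (x * (S.unif ^ (k + i : ℤ) * S.u t)) : ℂ) *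
      S.spectralVec hμ hF hFfin k s x ∂μ =
      ∫ x in S.unif ^ (-(k + i : ℤ)) • E, (S.χ (x * (S.unif ^ (k + i : ℤ) * S.u t)) : ℂ) *
      ((((S.q : ℝ) ^ (-(k : ℝ) / 2) : ℝ) : ℂ) *
        S.modIndicator (S.unif ^ (-k) • F) (S.unif ^ k * -S.u s) x) ∂μ := by
    refine integral_congr_ae (ae_restrict_of_ae ?_)
    filter_upwards [S.coeFn_spectralVec hμ hF hFfin k s] with x hx
    rw [hx]
  rw [h1, S.setIntegral_zpow_smul hμ _ hE, ← integral_indicator hE,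
    ← integral_indicator (hE.inter hFm), neg_neg, ← mul_assoc, ← Complex.ofReal_mul]
  have h2 : ∀ y, E.indicator (fun y => (S.χ (S.unif ^ (-(k + i : ℤ)) * y *
      (S.unif ^ (k + i : ℤ) * S.u t)) : ℂ) * ((((S.q : ℝ) ^ (-(k : ℝ) / 2) : ℝ) : ℂ) *
      S.modIndicator (S.unif ^ (-k) • F) (S.unif ^ k * -S.u s) (S.unif ^ (-(k + i : ℤ)) * y))) y =
      (((S.q : ℝ) ^ (-(k : ℝ) / 2) : ℝ) : ℂ) * (E ∩ S.unif ^ i • F).indicator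
        (fun y => (S.χ (y * (S.u t - S.unif⁻¹ ^ i * S.u s)) : ℂ)) y := by
    intro y
    have hy : S.unif ^ (-(k + i : ℤ)) * y ∈ S.unif ^ (-k) • F ↔ y ∈ S.unif ^ i • F := by
      rw [S.mem_zpow_smul_iff, ← zpow_natCast, S.mem_zpow_smul_iff, ← mul_assoc,
        ← zpow_add₀ hu]
      congr! 3
      ring
    by_cases h : y ∈ E
    · rw [Set.indicator_of_mem h]
      by_cases h' : y ∈ S.unif ^ i • F
      · rw [modIndicator, Set.indicator_of_mem (hy.2 h'),
          Set.indicator_of_mem (show y ∈ E ∩ S.unif ^ i • F from ⟨h, h'⟩), mul_left_comm,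
          ← S.chi_add]
        congr 3
        have e1 : S.unif ^ (-(k + i : ℤ)) * S.unif ^ (k + i : ℤ) = 1 := by
          rw [← zpow_add₀ hu]; simp
        have e2 : S.unif ^ (-(k + i : ℤ)) * S.unif ^ k = S.unif⁻¹ ^ i := by
          rw [← zpow_add₀ hu, inv_pow, ← zpow_natCast, ← zpow_neg]
          congr 1
          ring
        rw [← e2]
        linear_combination (y * S.u t) * e1
      · rw [modIndicator, Set.indicator_of_notMem (mt hy.1 h'),
          Set.indicator_of_notMem (fun hm => h' hm.2)]
        simp
    · rw [Set.indicator_of_notMem h, Set.indicator_of_notMem (fun hm => h hm.1), mul_zero]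
  simp only [h2]
  rw [integral_const_mul, ← mul_assoc, ← Complex.ofReal_mul]
  congr 3
  rw [← Real.rpow_intCast, ← Real.rpow_add hq, ← Real.rpow_add hq]
  congr 1
  push_cast
  ring

variable (hW : ∀ m, MeasurableSet (W m)) (hfin : ∀ m, μ (W m) ≠ ∞)

omit hμ in
-- Inner products are lattice coefficients of periodized indicators, and these coefficients
-- determine the periodization; negative level differences follow by conjugate symmetry.
theorem orthonormal_spectralVec_iff (hμ : μ (closedBall (0 : K) 1) = 1) :
    Orthonormal ℂ (fun x : Fin L × ℤ × ℕ =>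
      S.spectralVec hμ (hW x.1) (hfin x.1) x.2.1 x.2.2) ↔ S.SetOrthogonality μ W := by
  classical
  have hq := S.q_pos
  have hm : ∀ (l m : Fin L) (i : ℕ), MeasurableSet (W l ∩ S.unif ^ i • W m) := fun l m i => by
    rw [← zpow_natCast]
    exact (hW l).inter (S.measurableSet_zpow_smul (hW m) i)
  rw [orthonormal_iff_ite]
  constructor
  · intro h l m i
    set n : ℕ := if i = 0 ∧ l = m then 1 else 0 with hn
    have hchi : ∀ t : ℕ, ∫ y in W l ∩ S.unif ^ i • W m, (S.χ (y * S.u t) : ℂ) ∂μ =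
        if t = 0 then (n : ℂ) else 0 := by
      intro t
      -- Fixing level 0 and translation 0 in the second vector already yields every lattice
      -- coefficient.
      have h1 := h (l, i, t) (m, 0, 0)
      have h2 := S.inner_spectralVec_spectralVec hμ (hW l) (hW m) (hfin l) (hfin m) 0 i t 0
      rw [zero_add, S.u_zero, mul_zero, sub_zero] at h2
      simp only [Prod.mk.injEq, Nat.cast_eq_zero] at h1
      rw [h2] at h1
      by_cases hi : i = 0
      · simp only [hi, Nat.cast_zero, zero_div, Real.rpow_zero, Complex.ofReal_one, one_mul,
          true_and] at h1 hn ⊢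
        rw [h1, hn]
        by_cases ht : t = 0 <;> by_cases hlm : l = m <;> simp [ht, hlm]
      · rw [if_neg (by tauto)] at h1
        have hn0 : n = 0 := by rw [hn, if_neg (by tauto)]
        rw [hn0]
        have hne : (((S.q : ℝ) ^ ((i : ℝ) / 2) : ℝ) : ℂ) ≠ 0 := by
          exact_mod_cast (Real.rpow_pos_of_pos hq _).ne'
        rw [(mul_eq_zero.1 h1).resolve_left hne]
        simp
    have hA : μ (W l ∩ S.unif ^ i • W m) ≠ ∞ :=
      ne_top_of_le_ne_top (hfin l) (measure_mono Set.inter_subset_left)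
    have key := S.ae_tsum_indicator_eq_of_setIntegral_chi hμ (hm l m i) hA (n := n) ?_ ?_
    · filter_upwards [key] with ξ hξ
      rw [hξ, hn]
      split_ifs <;> simp
    · rintro _ ⟨t, rfl⟩ ht
      rw [hchi, if_neg]
      rintro rfl
      exact ht S.u_zero
    · have := hchi 0
      rwa [S.u_zero, if_pos rfl] at this
  · intro h
    have key : ∀ (l m : Fin L) (k : ℤ) (i t s : ℕ),
        inner ℂ (S.spectralVec hμ (hW l) (hfin l) (k + i) t)
          (S.spectralVec hμ (hW m) (hfin m) k s) =
          if i = 0 ∧ l = m ∧ t = s then 1 else 0 := by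
      intro l m k i t s
      have hae : ∀ᵐ ξ ∂μ, ∑' t : ℕ, (W l ∩ S.unif ^ i • W m).indicator
          (fun _ => (1 : ℝ≥0∞)) (ξ + S.u t) = ((if i = 0 ∧ l = m then 1 else 0 : ℕ) : ℝ≥0∞) := by
        filter_upwards [h l m i] with ξ hξ
        rw [hξ]
        split_ifs <;> simp
      rw [S.inner_spectralVec_spectralVec, S.setIntegral_chi_of_ae_tsum_indicator_eq hμ
        (hm l m i) hae (sub_mem (S.u_mem_lattice t)
          (S.unif_inv_pow_mul_mem_lattice (S.u_mem_lattice s) i))]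
      by_cases hi : i = 0
      · subst hi
        have e : S.u t - S.unif⁻¹ ^ 0 * S.u s = 0 ↔ t = s := by
          rw [pow_zero, one_mul, sub_eq_zero]
          exact S.u_injective.eq_iff
        simp only [e]
        by_cases hlm : l = m <;> by_cases hts : t = s <;> simp [hlm, hts]
      · simp [hi]
    rintro ⟨l, j, t⟩ ⟨m, k, s⟩
    simp only [Prod.mk.injEq]
    rcases le_total k j with hkj | hjk
    · obtain ⟨i, hi⟩ := Int.eq_ofNat_of_zero_le (sub_nonneg.2 hkj)
      obtain rfl : j = k + i := by linarith
      rw [key]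
      refine if_congr ?_ rfl rfl
      simp only [add_eq_left, Nat.cast_eq_zero]
      tauto
    · obtain ⟨i, hi⟩ := Int.eq_ofNat_of_zero_le (sub_nonneg.2 hjk)
      obtain rfl : k = j + i := by linarith
      rw [← inner_conj_symm, key, apply_ite (starRingEnd ℂ), map_one, map_zero]
      refine if_congr ?_ rfl rfl
      simp only [left_eq_add, Nat.cast_eq_zero]
      constructor
      · rintro ⟨h1, h2, h3⟩; exact ⟨h2.symm, h1, h3.symm⟩
      · rintro ⟨h1, h2, h3⟩; exact ⟨h2, h1.symm, h3.symm⟩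

omit hμ in
-- The indicator of a bounded piece of the uncovered set is in `L²` and orthogonal to every vector
-- of the system, hence zero.
theorem cover_of_complete (hμ : μ (closedBall (0 : K) 1) = 1)
    (hc : ∀ f : Lp ℂ 2 μ, (∀ x : Fin L × ℤ × ℕ,
      inner ℂ (S.spectralVec hμ (hW x.1) (hfin x.1) x.2.1 x.2.2) f = 0) → f = 0) :
    ∀ᵐ ξ ∂μ, ∃ (j : ℤ) (m : Fin L), ξ ∈ S.unif ^ j • W m := by
  set V : Set K := ⋃ (j : ℤ) (m : Fin L), S.unif ^ j • W m with hV
  have hVm : MeasurableSet V := MeasurableSet.iUnion fun j => MeasurableSet.iUnion fun m =>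
    S.measurableSet_zpow_smul (hW m) j
  have h0 : ∀ n : ℕ, μ (Vᶜ ∩ closedBall (0 : K) n) = 0 := by
    intro n
    have hm : MeasurableSet (Vᶜ ∩ closedBall (0 : K) n) := hVm.compl.inter measurableSet_closedBall
    have hf : μ (Vᶜ ∩ closedBall (0 : K) n) ≠ ∞ := ne_top_of_le_ne_top
      (isCompact_closedBall (0 : K) n).measure_lt_top.ne (measure_mono Set.inter_subset_right)
    have hz := hc (indicatorConstLp 2 hm hf (1 : ℂ)) fun x => by
      rw [S.inner_spectralVec]
      convert mul_zero _
      rw [← integral_zero K ℂ (μ := μ.restrict (S.unif ^ (-x.2.1) • W x.1))]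
      refine integral_congr_ae ((ae_restrict_iff' (S.measurableSet_zpow_smul (hW x.1) _)).2 ?_)
      filter_upwards [indicatorConstLp_coeFn (p := 2) (hs := hm) (hμs := hf) (c := (1 : ℂ))]
        with ξ hξ hmem
      rw [hξ, Set.indicator_of_notMem, mul_zero]
      exact fun h => h.1 (Set.mem_iUnion₂.2 ⟨_, _, hmem⟩)
    rw [Lp.eq_zero_iff_ae_eq_zero] at hz
    refine measure_eq_zero_iff_ae_notMem.2 ?_
    filter_upwards [hz, indicatorConstLp_coeFn (p := 2) (hs := hm) (hμs := hf) (c := (1 : ℂ))]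
      with ξ h1 h2 h3
    rw [h2, Set.indicator_of_mem h3] at h1
    exact one_ne_zero h1
  have h1 := measure_iUnion_null h0
  filter_upwards [measure_eq_zero_iff_ae_notMem.1 h1] with ξ hξ
  by_contra hne
  apply hξ
  obtain ⟨n, hn⟩ := exists_nat_ge ‖ξ‖
  refine Set.mem_iUnion.2 ⟨n, fun h => hne ?_, by rwa [mem_closedBall, dist_zero_right]⟩
  obtain ⟨j, m, h'⟩ := Set.mem_iUnion₂.1 h
  exact ⟨j, m, h'⟩

omit hμ in
-- By (a) with `l = m` and `j = 0`, each `W_m` is a fundamental domain. Pulling f back from `𝔭^{-j}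
-- W_m` to `W_m` turns the orthogonality relations into vanishing lattice coefficients, so f
-- vanishes on each dilate.
theorem complete_of_cover (hμ : μ (closedBall (0 : K) 1) = 1) (hS : S.SetOrthogonality μ W)
    (hcov : ∀ᵐ ξ ∂μ, ∃ (j : ℤ) (m : Fin L), ξ ∈ S.unif ^ j • W m)
    (f : Lp ℂ 2 μ) (hf : ∀ x : Fin L × ℤ × ℕ,
      inner ℂ (S.spectralVec hμ (hW x.1) (hfin x.1) x.2.1 x.2.2) f = 0) : f = 0 := by
  have hq := S.q_pos
  have hu := S.unif_ne_zero
  have key : ∀ (j : ℤ) (m : Fin L), ∀ᵐ ξ ∂μ, ξ ∈ S.unif ^ (-j) • W m → f ξ = 0 := by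
    intro j m
    have htile : ∀ᵐ ξ ∂μ, ∑' t, (W m).indicator (fun _ => (1 : ℝ≥0∞)) (ξ + S.u t) = 1 := by
      filter_upwards [hS m m 0] with ξ hξ
      simpa using hξ
    have hint : IntegrableOn (fun y => f (S.unif ^ (-j) * y)) (W m) μ := by
      have h1 : Integrable ((S.unif ^ (-j) • W m).indicator f) (μ.map (S.dilation (-j))) := by
        rw [S.map_dilation hμ]
        refine Integrable.smul_measure ?_ ENNReal.ofReal_ne_top
        rw [integrable_indicator_iff (S.measurableSet_zpow_smul (hW m) _)]
        exact integrableOn_of_lp (S.measure_zpow_smul_ne_top hμ (hfin m) _) f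
      rw [integrable_map_equiv] at h1
      rw [← integrable_indicator_iff (hW m)]
      refine h1.congr (Eventually.of_forall fun y => ?_)
      have e : S.unif ^ (-j) * y ∈ S.unif ^ (-j) • W m ↔ y ∈ W m := by
        rw [S.mem_zpow_smul_iff, S.zpow_neg_mul_cancel]
      by_cases hy : y ∈ W m
      · simp only [Function.comp, dilation_apply, Set.indicator_of_mem hy,
          Set.indicator_of_mem (e.2 hy)]
      · simp only [Function.comp, dilation_apply, Set.indicator_of_notMem hy,
          Set.indicator_of_notMem (mt e.1 hy)]
    have hz := S.ae_eq_zero_of_tsum_indicator_eq_one hμ (hW m) htile hint ?_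
    · filter_upwards [(S.quasiMeasurePreserving_dilation hμ j).ae hz] with ξ hξ hmem
      rw [S.mem_zpow_smul_iff, neg_neg] at hmem
      have := hξ hmem
      rwa [dilation_apply, S.zpow_neg_mul_cancel] at this
    · rintro _ ⟨t, rfl⟩
      have h1 := hf (m, j, t)
      rw [S.inner_spectralVec, S.setIntegral_zpow_smul hμ _ (hW m)] at h1
      have hne : (((S.q : ℝ) ^ (-(j : ℝ) / 2) : ℝ) : ℂ) ≠ 0 := by
        exact_mod_cast (Real.rpow_pos_of_pos hq _).ne'
      have hne' : (((S.q : ℝ) ^ (- -j) : ℝ) : ℂ) ≠ 0 := by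
        exact_mod_cast (zpow_pos hq _).ne'
      have h2 := (mul_eq_zero.1 ((mul_eq_zero.1 h1).resolve_left hne)).resolve_left hne'
      rw [← h2]
      congr 1
      ext y
      congr 3
      have e : S.unif ^ (-j) * S.unif ^ j = 1 := by rw [← zpow_add₀ hu]; simp
      linear_combination -(y * S.u t) * e
  rw [Lp.eq_zero_iff_ae_eq_zero]
  filter_upwards [hcov, ae_all_iff.2 fun j => ae_all_iff.2 fun m => key j m] with ξ h1 h2
  obtain ⟨j, m, hjm⟩ := h1
  exact h2 (-j) m (by rwa [neg_neg])

/-- A family whose Fourier transforms are indicators of the sets `W m` is a multiwavelet if and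
only if the Fourier transforms of its affine system form an orthonormal basis. -/
theorem isMultiwavelet_iff (ψ : Fin L → Lp ℂ 2 μ)
    (hψ : ∀ m, (W m).indicator 1 =ᵐ[μ] S.fourierL2 hμ (ψ m)) :
    S.IsMultiwavelet μ ψ ↔
      Orthonormal ℂ (fun x : Fin L × ℤ × ℕ =>
        S.spectralVec hμ (hW x.1) (hfin x.1) x.2.1 x.2.2) ∧
      ∀ f : Lp ℂ 2 μ, (∀ x : Fin L × ℤ × ℕ,
        inner ℂ (S.spectralVec hμ (hW x.1) (hfin x.1) x.2.1 x.2.2) f = 0) → f = 0 := by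
  choose A hA using S.exists_affine_isometry hμ
  have hAv : ∀ x : Fin L × ℤ × ℕ, S.fourierL2 hμ (A x.2.1 x.2.2 (ψ x.1)) =
      S.spectralVec hμ (hW x.1) (hfin x.1) x.2.1 x.2.2 := by
    rintro ⟨l, j, t⟩
    refine Lp.ext ?_
    filter_upwards [S.fourierL2_affine hμ (hA j t) (ψ l), S.coeFn_spectralVec hμ (hW l) (hfin l) j t,
      (S.quasiMeasurePreserving_dilation hμ j).ae (hψ l)] with ξ h1 h2 h3
    rw [h1, h2]
    rw [dilation_apply] at h3
    rw [← h3, mul_assoc]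
    congr 1
    have e : ξ ∈ S.unif ^ (-j) • W l ↔ S.unif ^ j * ξ ∈ W l := by
      rw [S.mem_zpow_smul_iff, neg_neg]
    by_cases hξ : ξ ∈ S.unif ^ (-j) • W l
    · rw [modIndicator, Set.indicator_of_mem hξ, Set.indicator_of_mem (e.1 hξ), Pi.one_apply,
        mul_one]
    · rw [modIndicator, Set.indicator_of_notMem hξ, Set.indicator_of_notMem (mt e.2 hξ), mul_zero]
  have h1 : S.IsMultiwavelet μ ψ ↔ ∃ b : HilbertBasis (Fin L × ℤ × ℕ) ℂ (Lp ℂ 2 μ),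
      ∀ x, b x = A x.2.1 x.2.2 (ψ x.1) := by
    constructor
    · rintro ⟨b, hb⟩
      exact ⟨b, fun x => Lp.ext ((hb x.1 x.2.1 x.2.2).trans (hA _ _ _).symm)⟩
    · rintro ⟨b, hb⟩
      refine ⟨b, fun l j t => ?_⟩
      rw [hb]
      exact hA j t (ψ l)
  rw [h1, exists_hilbertBasis_iff]
  have h2 : (fun x : Fin L × ℤ × ℕ => S.spectralVec hμ (hW x.1) (hfin x.1) x.2.1 x.2.2) =
      S.fourierL2 hμ ∘ fun x => A x.2.1 x.2.2 (ψ x.1) := funext fun x => (hAv x).symm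
  refine and_congr ?_ ?_
  · rw [h2]
    exact ((S.fourierL2 hμ).toLinearIsometry.orthonormal_comp_iff).symm
  · simp only [← hAv]
    constructor
    · intro h f hf
      obtain ⟨g, rfl⟩ := (S.fourierL2 hμ).surjective f
      simp only [LinearIsometryEquiv.inner_map_map] at hf
      rw [h g hf, map_zero]
    · intro h g hg
      have := h (S.fourierL2 hμ g) fun x => by rw [LinearIsometryEquiv.inner_map_map, hg]
      exact (map_eq_zero_iff _ (S.fourierL2 hμ).injective).1 this

theorem isMultiwavelet_iff_setOrthogonality (hW : ∀ m, MeasurableSet (W m)) (ψ : Fin L → Lp ℂ 2 μ)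
    (hψ : ∀ m, S.IsFourierTransform μ (ψ m) ((W m).indicator 1)) :
    S.IsMultiwavelet μ ψ ↔ S.SetOrthogonality μ W ∧ S.DilatesPartition μ W := by
  have hae : ∀ m, (W m).indicator 1 =ᵐ[μ] S.fourierL2 hμ (ψ m) := fun m =>
    IsFourierTransform.ae_eq_fourierL2 S hμ
      ((measurable_one.indicator (hW m)).aestronglyMeasurable) (hψ m)
  -- Finite measure is not assumed; it follows because the indicator is the transform of an `L²`
  -- function.
  have hfin : ∀ m, μ (W m) ≠ ∞ := by
    intro m
    have h := (memLp_congr_ae (hae m)).2 (Lp.memLp (S.fourierL2 hμ (ψ m)))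
    have h' := (memLp_indicator_iff_restrict (hW m)).1 h
    have h2 := (memLp_const_iff (c := (1 : ℂ)) two_ne_zero ENNReal.ofNat_ne_top).1 h'
    have h3 := h2.resolve_left one_ne_zero
    rw [Measure.restrict_apply_univ] at h3
    exact h3.ne
  rw [S.isMultiwavelet_iff hμ hW hfin ψ hae, S.orthonormal_spectralVec_iff hW hfin hμ]
  refine and_congr_right fun hS => ?_
  rw [S.dilatesPartition_iff_cover hμ hW hS]
  exact ⟨S.cover_of_complete hW hfin hμ, S.complete_of_cover hW hfin hμ hS⟩

end Spectral

end AffineSetting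

theorem mainTheorem3 {K : Type*} [NontriviallyNormedField K] [IsUltrametricDist K]
    [LocallyCompactSpace K] [MeasurableSpace K] [BorelSpace K]
    {p c : ℕ} [Fact p.Prime] [CharP K p] (S : AffineSetting K p c)
    (μ : Measure K) [μ.IsAddHaarMeasure] (hμ : μ (closedBall (0 : K) 1) = 1)
    {L : ℕ} (ψ : Fin L → Lp ℂ 2 μ) (W : Fin L → Set K) (hW : ∀ m, MeasurableSet (W m))
    (hψ : ∀ m, S.IsFourierTransform μ (ψ m) ((W m).indicator 1)) :
    List.TFAE [
      S.IsMultiwaveletSet μ W,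
      S.SetOrthogonality μ W ∧ S.DilatesPartition μ W,
      S.SetOrthogonality μ W ∧
        ∫⁻ ξ in ⋃ m, W m, ‖ξ‖ₑ⁻¹ ∂μ = ((S.q : ℝ≥0∞) - 1) / (S.q : ℝ≥0∞)] := by
  have : ProperSpace K := ProperSpace.of_locallyCompactSpace K
  tfae_have 1 ↔ 2 := by
    constructor
    -- The definition only provides some multiwavelet `ψ'` with these transforms, so the equivalence
    -- is applied to `ψ'` here and to the given `ψ` in the converse.
    · rintro ⟨_, ψ', hm, hψ'⟩
      exact (S.isMultiwavelet_iff_setOrthogonality hμ hW ψ' hψ').1 hm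
    · intro h
      exact ⟨hW, ψ, (S.isMultiwavelet_iff_setOrthogonality hμ hW ψ hψ).2 h, hψ⟩
  tfae_have 2 ↔ 3 := and_congr_right fun h => by
    rw [S.dilatesPartition_iff_cover hμ hW h, S.cover_iff_lintegral hμ hW h]
  tfae_finish
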